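/- A *quantum norm* on a complex linear space $E$ is a sequence of norms on the matrix spaces $M_n(E)$, $n=1,2,\dots$, satisfying Ruan's axioms $\|\alpha v\beta\|_n\le\|\alpha\|\,\|v\|_m\,\|\beta\|$ for all $v\in M_m(E)$ and all scalar matrices $\alpha$ of size $n\times m$ and $\beta$ of size $m\times n$ (with their operator norms), and $\|v\oplus w\|_{m+n}=\max(\|v\|_m,\|w\|_n)$ for all $v\in M_m(E)$, $w\in M_n(E)$. A *quantum space* is a complex linear space with a quantum norm (not necessarily complete). A linear operator $\varphi:E\to F$ between quantum spaces is *completely contractive* if all its amplifications $\varphi_n:M_n(E)\to M_n(F)$, $(a_{kl})\mapsto(\varphi(a_{kl}))$, are contractive. Let $\mathbf{QNor}_1$ be the category of quantum spaces and completely contractive operators, and let $\odot:\mathbf{QNor}_1\to\mathbf{Set}$ be the faithful functor taking $E$ to $\prod_{n=1}^\infty \mathrm{Ball}(M_n(E))$ (the product of the closed unit balls) and $\varphi$ to $(u_n)_n\mapsto(\varphi_n(u_n))_n$. A quantum space $F$ is *free* with base a set $M$ (a *metrically free* quantum space) if there are bijections $\mathrm{Hom}_{\mathbf{Set}}(M,\odot(E))\to\mathrm{Hom}_{\mathbf{QNor}_1}(F,E)$,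 natural in the quantum space $E$. The category $\mathbf{QNor}_1$ with the rig $\odot$ is *freedom-loving* if every set is the base of a free quantum space. Let $\mathcal N_n$ be the space of trace-class operators on $\mathbb C^n$, with the quantum norm of the quantum dual of $\mathcal B(\mathbb C^n)$ under the identification of $b\in\mathcal N_n$ with the functional $a\mapsto\mathrm{tr}(ba)$; that is, the norm of $(b_{kl})\in M_m(\mathcal N_n)$ is the completely bounded norm of $\mathcal B(\mathbb C^n)\to M_m(\mathbb C)$, $a\mapsto(\mathrm{tr}(b_{kl}a))_{kl}$. **Theorem.** The category $\mathbf{QNor}_1$ has coproducts of all families indexed by sets (denoted $\oplus_1$), and $(\mathbf{QNor}_1,\odot)$ is freedom-loving. Moreover, (i) the free quantum space with a one-point base is, uniquely up to isomorphism in $\mathbf{QNor}_1$, the coproduct $\mathcal N_\infty=\mathcal N_1\oplus_1\mathcal N_2\oplus_1\cdots$ in $\mathbf{QNor}_1$ of the family $\{\mathcal N_n;\ n=1,2,\dots\}$; (ii) for every set $M$, the free quantum space with base $M$ is, uniquely up to isomorphism in $\mathbf{QNor}_1$, the coproduct in $\mathbf{QNor}_1$ of the family of copies of $\mathcal N_\infty$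 indexed by the points of $M$. -/

import Mathlib

open CategoryTheory CategoryTheory.Limits

universe u v₁ v₂ u₁ u₂

/-! ### Rigged categories and free objects -/

section Rigged

variable {K : Type u₁} [Category.{v₁} K] {L : Type u₂} [Category.{v₂} L]

/-- A rig of `K`: a faithful covariant functor from `K` to another category `L`.  A rigged category
is a category together with a rig. -/
structure Rig (K : Type u₁) [Category.{v₁} K] (L : Type u₂) [Category.{v₂} L] where
  functor : K ⥤ L
  faithful : functor.Faithful

/-- `F` is a free object with base `M`: there are bijections
`Hom(M, □ X) ≃ Hom(F, X)`, natural in `X`. -/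
def Rig.IsFree (R : Rig K L) (M : L) (F : K) : Prop :=
  ∃ I : ∀ X : K, (M ⟶ R.functor.obj X) ≃ (F ⟶ X),
    ∀ (X Y : K) (f : X ⟶ Y) (g : M ⟶ R.functor.obj X),
      I Y (g ≫ R.functor.map f) = I X g ≫ f

/-- A rigged category is freedom-loving if every object of `L` is the base of a free object. -/
def Rig.FreedomLoving (R : Rig K L) : Prop :=
  ∀ M : L, ∃ F : K, R.IsFree M F

end Rigged

/-! ### Quantum norms (operator space structures) -/

section Matrices

variable {E : Type*} [AddCommGroup E] [Module ℂ E]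

/-- The product `α v β` of a matrix `v` over `E` with scalar matrices `α`, `β`. -/
def sandwich {m n : ℕ} (α : Matrix (Fin n) (Fin m) ℂ) (v : Matrix (Fin m) (Fin m) E)
    (β : Matrix (Fin m) (Fin n) ℂ) : Matrix (Fin n) (Fin n) E :=
  Matrix.of fun i j => ∑ k, ∑ l, (α i k * β l j) • v k l

/-- The block-diagonal matrix `v ⊕ w`. -/
def blockSum {m n : ℕ} (v : Matrix (Fin m) (Fin m) E) (w : Matrix (Fin n) (Fin n) E) :
    Matrix (Fin (m + n)) (Fin (m + n)) E :=
  (Matrix.fromBlocks v 0 0 w).submatrix finSumFinEquiv.symm finSumFinEquiv.symm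

end Matrices

section

open scoped Matrix.Norms.L2Operator

/-- A quantum norm on a complex linear space `E`: a norm on every `M_n(E)`, subject to the axioms
of Ruan.  (The space `M_0(E)` is zero, so that the case `n = 0` carries no information.  The norm of a
scalar matrix is its operator norm between Euclidean spaces.) -/
structure QuantumNorm (E : Type u) [AddCommGroup E] [Module ℂ E] where
  nrm : ∀ n : ℕ, Seminorm ℂ (Matrix (Fin n) (Fin n) E)
  eq_zero : ∀ (n : ℕ) (v : Matrix (Fin n) (Fin n) E), nrm n v = 0 → v = 0
  nrm_sandwich_le : ∀ (m n : ℕ) (α : Matrix (Fin n) (Fin m) ℂ) (v : Matrix (Fin m) (Fin m) E)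
    (β : Matrix (Fin m) (Fin n) ℂ),
    nrm n (sandwich α v β) ≤ ‖α‖ * nrm m v * ‖β‖
  nrm_blockSum : ∀ (m n : ℕ) (v : Matrix (Fin m) (Fin m) E) (w : Matrix (Fin n) (Fin n) E),
    nrm (m + n) (blockSum v w) = max (nrm m v) (nrm n w)

end

/-- A linear operator is completely contractive if all its amplifications
`φ_n : M_n(E) → M_n(F)` are contractive. -/
def IsCompletelyContractive {E F : Type*} [AddCommGroup E] [Module ℂ E] [AddCommGroup F]
    [Module ℂ F] (P : QuantumNorm E) (Q : QuantumNorm F) (φ : E →ₗ[ℂ] F) : Prop :=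
  ∀ (n : ℕ) (v : Matrix (Fin n) (Fin n) E), Q.nrm n (v.map φ) ≤ P.nrm n v

/-- The completely bounded norm `sup_n ‖φ_n‖`, where `‖φ_n‖` is the supremum of `‖φ_n a‖` over the
closed unit ball of `M_n(E)`. -/
noncomputable def cbNorm {E F : Type*} [AddCommGroup E] [Module ℂ E] [AddCommGroup F]
    [Module ℂ F] (P : QuantumNorm E) (Q : QuantumNorm F) (φ : E →ₗ[ℂ] F) : ℝ :=
  sSup {c | ∃ (n : ℕ) (a : Matrix (Fin n) (Fin n) E), P.nrm n a ≤ 1 ∧ c = Q.nrm n (a.map φ)}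

/-! ### The category of quantum spaces and completely contractive operators -/

/-- A quantum (normed) space, not necessarily complete. -/
structure QNor : Type (u + 1) where
  carrier : Type u
  [addCommGroup : AddCommGroup carrier]
  [module : Module ℂ carrier]
  qnorm : QuantumNorm carrier

namespace QNor

attribute [instance] QNor.addCommGroup QNor.module

/-- Morphisms of quantum spaces: completely contractive operators. -/
@[ext]
structure Hom (E F : QNor.{u}) where
  toLin : E.carrier →ₗ[ℂ] F.carrier
  contractive : IsCompletelyContractive E.qnorm F.qnorm toLin

instance : Category.{u} QNor.{u} where
  Hom E F := Hom E F
  id E := ⟨LinearMap.id, fun _ _ => le_rfl⟩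
  comp f g := ⟨g.toLin ∘ₗ f.toLin, fun n v =>
    (g.contractive n (v.map f.toLin)).trans (f.contractive n v)⟩

end QNor

/-- The functor taking a quantum space `E` to the cartesian product over `n = 1, 2, …` of the closed
unit balls of `M_n(E)`, and a completely contractive operator to the product of the restrictions of
its amplifications. -/
def ballFunctor : QNor.{u} ⥤ Type u where
  obj E := ∀ n : ℕ+, {v : Matrix (Fin n) (Fin n) E.carrier // E.qnorm.nrm n v ≤ 1}
  map f := TypeCat.ofHom fun x n =>
    ⟨(x n).1.map f.toLin, (f.contractive n (x n).1).trans (x n).2⟩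
  map_id _ := rfl
  map_comp _ _ := rfl

theorem ballFunctor_faithful : ballFunctor.{u}.Faithful where
  map_injective {E F} f g h := by
    refine QNor.Hom.ext (LinearMap.ext fun x => ?_)
    let V : Matrix (Fin (1 : ℕ+)) (Fin (1 : ℕ+)) E.carrier := Matrix.of fun _ _ => x
    let r : ℝ := 1 + E.qnorm.nrm (1 : ℕ+) V
    have hr : 0 < r := by have := apply_nonneg (E.qnorm.nrm (1 : ℕ+)) V; positivity
    let w : ballFunctor.obj E := fun n =>
      if hn : n = 1 then ⟨((r⁻¹ : ℝ) : ℂ) • Matrix.of fun _ _ => x, by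
        subst hn
        have h1 : E.qnorm.nrm _ (((r⁻¹ : ℝ) : ℂ) • V) ≤ 1 := by
          rw [map_smul_eq_mul, Complex.norm_real, Real.norm_of_nonneg (by positivity),
            inv_mul_le_iff₀ hr]
          simp [r]
        exact h1⟩
      else ⟨0, by simp⟩
    have h2 := congrFun (congrArg (fun k => (ConcreteCategory.hom k : _ → _)) h) w
    have h3 := congrArg Subtype.val (congrFun h2 1)
    have h4 : f.toLin (((r⁻¹ : ℝ) : ℂ) • x) = g.toLin (((r⁻¹ : ℝ) : ℂ) • x) := by
      have h5 : (w 1).1 = Matrix.of fun _ _ => ((r⁻¹ : ℝ) : ℂ) • x := by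
        simp only [w, dif_pos rfl]
        rfl
      have h6 : (w 1).1.map f.toLin = (w 1).1.map g.toLin := h3
      rw [h5] at h6
      exact congrFun (congrFun h6 ⟨0, by simp⟩) ⟨0, by simp⟩
    rw [map_smul, map_smul] at h4
    exact smul_right_injective _ (by simpa using hr.ne') h4

/-- The rigged category of quantum spaces, with the product of unit balls as its rig. -/
def ballRig : Rig QNor.{u} (Type u) := ⟨ballFunctor, ballFunctor_faithful⟩

/-! ### Facts on operator norms of matrices -/

section OpNorm

open scoped Kronecker Matrix.Norms.L2Operator

section

variable {ι κ : Type*} [Fintype ι] [Fintype κ] [DecidableEq κ]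

theorem opNorm_le {A : Matrix ι κ ℂ} {C : ℝ} (hC : 0 ≤ C)
    (h : ∀ x : κ → ℂ, ∑ i, ‖(A.mulVec x) i‖ ^ 2 ≤ C ^ 2 * ∑ j, ‖x j‖ ^ 2) : ‖A‖ ≤ C := by
  rw [Matrix.l2_opNorm_def]
  refine ContinuousLinearMap.opNorm_le_bound _ hC fun x => ?_
  refine le_of_sq_le_sq ?_ (by positivity)
  rw [mul_pow, EuclideanSpace.norm_sq_eq, EuclideanSpace.norm_sq_eq]
  exact h x.ofLp

theorem sum_mulVec_le (A : Matrix ι κ ℂ) (x : κ → ℂ) :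
    ∑ i, ‖(A.mulVec x) i‖ ^ 2 ≤ ‖A‖ ^ 2 * ∑ j, ‖x j‖ ^ 2 := by
  have h := Matrix.l2_opNorm_mulVec A (WithLp.toLp 2 x)
  have h2 := pow_le_pow_left₀ (norm_nonneg _) h 2
  rw [mul_pow, EuclideanSpace.norm_sq_eq, EuclideanSpace.norm_sq_eq] at h2
  exact h2

theorem norm_one_kronecker_le {σ : Type*} [Fintype σ] [DecidableEq σ] (A : Matrix ι κ ℂ) :
    ‖(1 : Matrix σ σ ℂ) ⊗ₖ A‖ ≤ ‖A‖ := by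
  refine opNorm_le (norm_nonneg _) fun x => ?_
  have key : ∀ s i, (((1 : Matrix σ σ ℂ) ⊗ₖ A).mulVec x) (s, i) =
      (A.mulVec fun j => x (s, j)) i := by
    intro s i
    simp [Matrix.mulVec, dotProduct, Fintype.sum_prod_type, Matrix.one_apply]
  simp only [Fintype.sum_prod_type, key, Finset.mul_sum _ _ (‖A‖ ^ 2)]
  refine Finset.sum_le_sum fun s _ => ?_
  rw [← Finset.mul_sum]
  exact sum_mulVec_le A _

theorem norm_kronecker_one_le {σ : Type*} [Fintype σ] [DecidableEq σ] (A : Matrix ι κ ℂ) :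
    ‖A ⊗ₖ (1 : Matrix σ σ ℂ)‖ ≤ ‖A‖ := by
  refine opNorm_le (norm_nonneg _) fun x => ?_
  have key : ∀ i s, ((A ⊗ₖ (1 : Matrix σ σ ℂ)).mulVec x) (i, s) =
      (A.mulVec fun j => x (j, s)) i := by
    intro s i
    simp [Matrix.mulVec, dotProduct, Fintype.sum_prod_type, Matrix.one_apply]
  simp only [Fintype.sum_prod_type_right, key, Finset.mul_sum _ _ (‖A‖ ^ 2)]
  refine Finset.sum_le_sum fun s _ => ?_
  rw [← Finset.mul_sum]
  exact sum_mulVec_le A _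

theorem norm_submatrix_le {ι' κ' : Type*} [Fintype ι'] [Fintype κ'] [DecidableEq κ']
    (A : Matrix ι κ ℂ) (e : ι' ≃ ι) (f : κ' ≃ κ) : ‖A.submatrix e f‖ ≤ ‖A‖ := by
  refine opNorm_le (norm_nonneg _) fun x => ?_
  have h := sum_mulVec_le A (x ∘ f.symm)
  have h1 : ∀ i, ((A.submatrix e f).mulVec x) i = (A.mulVec (x ∘ f.symm)) (e i) := by
    intro i
    rw [Matrix.submatrix_mulVec_equiv]
    rfl
  simp only [h1]
  rw [Equiv.sum_comp e (fun i => ‖(A.mulVec (x ∘ f.symm)) i‖ ^ 2)]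
  refine h.trans_eq ?_
  congr 1
  exact Equiv.sum_comp f.symm (fun i => ‖x i‖ ^ 2)

theorem norm_fromBlocks_le {ι' κ' : Type*} [Fintype ι'] [Fintype κ'] [DecidableEq κ']
    (A : Matrix ι κ ℂ) (D : Matrix ι' κ' ℂ) :
    ‖Matrix.fromBlocks A 0 0 D‖ ≤ max ‖A‖ ‖D‖ := by
  refine opNorm_le (le_max_of_le_left (norm_nonneg _)) fun x => ?_
  rw [Matrix.fromBlocks_mulVec]
  simp only [Fintype.sum_sum_type, Sum.elim_inl, Sum.elim_inr, Matrix.zero_mulVec, add_zero,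
    zero_add, mul_add]
  refine add_le_add ((sum_mulVec_le A _).trans ?_) ((sum_mulVec_le D _).trans ?_)
  · exact mul_le_mul_of_nonneg_right
      (pow_le_pow_left₀ (norm_nonneg _) (le_max_left _ _) 2) (by positivity)
  · exact mul_le_mul_of_nonneg_right
      (pow_le_pow_left₀ (norm_nonneg _) (le_max_right _ _) 2) (by positivity)

end

theorem comp_sandwich {m n k : ℕ} (α : Matrix (Fin n) (Fin m) ℂ)
    (v : Matrix (Fin m) (Fin m) (Matrix (Fin k) (Fin k) ℂ)) (β : Matrix (Fin m) (Fin n) ℂ) :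
    Matrix.comp _ _ _ _ ℂ (sandwich α v β) =
      (α ⊗ₖ (1 : Matrix (Fin k) (Fin k) ℂ)) * Matrix.comp _ _ _ _ ℂ v *
        (β ⊗ₖ (1 : Matrix (Fin k) (Fin k) ℂ)) := by
  ext ⟨i, p⟩ ⟨j, q⟩
  simp [sandwich, Matrix.mul_apply, Fintype.sum_prod_type, Matrix.one_apply, Matrix.sum_apply,
    Finset.sum_mul]
  rw [Finset.sum_comm]
  refine Finset.sum_congr rfl fun l _ => Finset.sum_congr rfl fun k _ => ?_
  ring

theorem comp_map_mul {r m k : ℕ} (γ : Matrix (Fin m) (Fin k) ℂ)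
    (w : Matrix (Fin r) (Fin r) (Matrix (Fin k) (Fin k) ℂ)) (δ : Matrix (Fin k) (Fin m) ℂ) :
    Matrix.comp _ _ _ _ ℂ (w.map fun a => γ * a * δ) =
      ((1 : Matrix (Fin r) (Fin r) ℂ) ⊗ₖ γ) * Matrix.comp _ _ _ _ ℂ w *
        ((1 : Matrix (Fin r) (Fin r) ℂ) ⊗ₖ δ) := by
  ext ⟨i, p⟩ ⟨j, q⟩
  simp [Matrix.mul_apply, Fintype.sum_prod_type, Matrix.one_apply]

theorem norm_comp_sandwich_le {m n k : ℕ} (α : Matrix (Fin n) (Fin m) ℂ)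
    (v : Matrix (Fin m) (Fin m) (Matrix (Fin k) (Fin k) ℂ)) (β : Matrix (Fin m) (Fin n) ℂ) :
    ‖Matrix.comp _ _ _ _ ℂ (sandwich α v β)‖ ≤ ‖α‖ * ‖Matrix.comp _ _ _ _ ℂ v‖ * ‖β‖ := by
  rw [comp_sandwich]
  refine (Matrix.l2_opNorm_mul _ _).trans ?_
  gcongr
  · refine (Matrix.l2_opNorm_mul _ _).trans ?_
    gcongr
    exact norm_kronecker_one_le α
  · exact norm_kronecker_one_le β

theorem norm_comp_blockSum_le {m n k : ℕ} (v : Matrix (Fin m) (Fin m) (Matrix (Fin k) (Fin k) ℂ))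
    (w : Matrix (Fin n) (Fin n) (Matrix (Fin k) (Fin k) ℂ)) :
    ‖Matrix.comp _ _ _ _ ℂ (blockSum v w)‖ ≤
      max ‖Matrix.comp _ _ _ _ ℂ v‖ ‖Matrix.comp _ _ _ _ ℂ w‖ := by
  have h : Matrix.comp _ _ _ _ ℂ (blockSum v w) =
      (Matrix.fromBlocks (Matrix.comp _ _ _ _ ℂ v) 0 0 (Matrix.comp _ _ _ _ ℂ w)).submatrix
        ((finSumFinEquiv.symm.prodCongr (Equiv.refl _)).trans (Equiv.sumProdDistrib _ _ _))
        ((finSumFinEquiv.symm.prodCongr (Equiv.refl _)).trans (Equiv.sumProdDistrib _ _ _)) := by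
    ext ⟨i, p⟩ ⟨j, q⟩
    obtain ⟨i, rfl⟩ := finSumFinEquiv.surjective i
    obtain ⟨j, rfl⟩ := finSumFinEquiv.surjective j
    rcases i with i | i <;> rcases j with j | j <;>
      simp [blockSum, -finSumFinEquiv_apply_left, -finSumFinEquiv_apply_right]
  rw [h]
  exact (norm_submatrix_le _ _ _).trans (norm_fromBlocks_le _ _)

theorem norm_comp_map_mul_le {r m k : ℕ} (γ : Matrix (Fin m) (Fin k) ℂ)
    (w : Matrix (Fin r) (Fin r) (Matrix (Fin k) (Fin k) ℂ)) (δ : Matrix (Fin k) (Fin m) ℂ) :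
    ‖Matrix.comp _ _ _ _ ℂ (w.map fun a => γ * a * δ)‖ ≤
      ‖γ‖ * ‖Matrix.comp _ _ _ _ ℂ w‖ * ‖δ‖ := by
  rw [comp_map_mul]
  refine (Matrix.l2_opNorm_mul _ _).trans ?_
  gcongr
  · refine (Matrix.l2_opNorm_mul _ _).trans ?_
    gcongr
    exact norm_one_kronecker_le γ
  · exact norm_one_kronecker_le δ

/-- In the presence of the other axioms, Ruan's axiom on block sums needs only one inequality. -/
theorem max_le_nrm_blockSum {E : Type*} [AddCommGroup E] [Module ℂ E]
    (p : ∀ n : ℕ, Matrix (Fin n) (Fin n) E → ℝ) (hp : ∀ n v, 0 ≤ p n v)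
    (h : ∀ (m n : ℕ) (α : Matrix (Fin n) (Fin m) ℂ) (v : Matrix (Fin m) (Fin m) E)
      (β : Matrix (Fin m) (Fin n) ℂ), p n (sandwich α v β) ≤ ‖α‖ * p m v * ‖β‖)
    (m n : ℕ) (v : Matrix (Fin m) (Fin m) E) (w : Matrix (Fin n) (Fin n) E) :
    max (p m v) (p n w) ≤ p (m + n) (blockSum v w) := by
  have hone : ∀ k : ℕ, ‖(1 : Matrix (Fin k) (Fin k) ℂ)‖ ≤ 1 := fun k =>
    opNorm_le zero_le_one fun x => by simp
  have main : ∀ (k l : ℕ) (e : Fin k → Fin l) (he : Function.Injective e)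
      (v : Matrix (Fin l) (Fin l) E), p k (v.submatrix e e) ≤ p l v := by
    intro k l e he v
    let α : Matrix (Fin k) (Fin l) ℂ := Matrix.of fun i j => if e i = j then 1 else 0
    let β : Matrix (Fin l) (Fin k) ℂ := Matrix.of fun i j => if e j = i then 1 else 0
    have hβ : ‖β‖ ≤ 1 := by
      have h1 : β.conjTranspose * β = 1 := by
        ext i j
        simp [β, Matrix.mul_apply, Matrix.one_apply, he.eq_iff, eq_comm]
      have h2 := Matrix.l2_opNorm_conjTranspose_mul_self β
      rw [h1] at h2
      nlinarith [hone k, norm_nonneg β]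
    have hα : ‖α‖ ≤ 1 := by
      have : α = β.conjTranspose := by
        ext i j
        simp [α, β, apply_ite]
      rw [this, Matrix.l2_opNorm_conjTranspose]
      exact hβ
    have h3 : v.submatrix e e = sandwich α v β := by
      ext i j
      simp [sandwich, α, β]
    rw [h3]
    refine (h l k α v β).trans ?_
    have := hp l v
    calc ‖α‖ * p l v * ‖β‖ ≤ 1 * p l v * 1 := by gcongr
      _ = p l v := by ring
  refine max_le ?_ ?_
  · have := main m (m + n) (Fin.castAdd n) (Fin.castAdd_injective m n) (blockSum v w)
    have h4 : (blockSum v w).submatrix (Fin.castAdd n) (Fin.castAdd n) = v := by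
      ext i j
      simp [blockSum]
    rwa [h4] at this
  · have := main n (m + n) (Fin.natAdd m) (Fin.natAdd_injective n m) (blockSum v w)
    have h4 : (blockSum v w).submatrix (Fin.natAdd m) (Fin.natAdd m) = w := by
      ext i j
      simp [blockSum]
    rwa [h4] at this

/-- The standard quantum norm on the space `M_k = B(ℂ^k)` of `k × k` matrices: the norm on `M_n(M_k)`
is the operator norm on `B(ℂ^n ⊗ ℂ^k)`. -/
noncomputable def matrixQuantumNorm (k : ℕ) : QuantumNorm (Matrix (Fin k) (Fin k) ℂ) where
  nrm n := Seminorm.of (fun a => ‖Matrix.comp _ _ _ _ ℂ a‖)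
    (fun a b => norm_add_le (Matrix.comp _ _ _ _ ℂ a) (Matrix.comp _ _ _ _ ℂ b))
    (fun c a => norm_smul c (Matrix.comp _ _ _ _ ℂ a))
  eq_zero n v hv := by
    have h : Matrix.comp _ _ _ _ ℂ v = 0 := norm_eq_zero.1 hv
    ext i j p q
    exact congrFun (congrFun h (i, p)) (j, q)
  nrm_sandwich_le m n α v β := norm_comp_sandwich_le α v β
  nrm_blockSum m n v w := by
    refine le_antisymm ?_ ?_
    · exact norm_comp_blockSum_le v w
    · refine max_le_nrm_blockSum
        (fun n (a : Matrix (Fin n) (Fin n) (Matrix (Fin k) (Fin k) ℂ)) =>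
          ‖Matrix.comp _ _ _ _ ℂ a‖)
        (fun _ _ => norm_nonneg _) (fun m n α v β => norm_comp_sandwich_le α v β) m n v w

/-! ### Facts on completely bounded norms -/

section cb

variable {E F : Type*} [AddCommGroup E] [Module ℂ E] [AddCommGroup F] [Module ℂ F]
  {P : QuantumNorm E} {Q : QuantumNorm F}

/-- The set of numbers whose supremum is the completely bounded norm. -/
def cbSet (P : QuantumNorm E) (Q : QuantumNorm F) (φ : E →ₗ[ℂ] F) : Set ℝ :=
  {c | ∃ (n : ℕ) (a : Matrix (Fin n) (Fin n) E), P.nrm n a ≤ 1 ∧ c = Q.nrm n (a.map φ)}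

theorem cbNorm_nonneg (φ : E →ₗ[ℂ] F) : 0 ≤ cbNorm P Q φ := by
  refine Real.sSup_nonneg ?_
  rintro c ⟨n, a, -, rfl⟩
  exact apply_nonneg _ _

theorem cbNorm_le {φ : E →ₗ[ℂ] F} {C : ℝ} (hC : 0 ≤ C)
    (h : ∀ (n : ℕ) (a : Matrix (Fin n) (Fin n) E), P.nrm n a ≤ 1 → Q.nrm n (a.map φ) ≤ C) :
    cbNorm P Q φ ≤ C := by
  refine Real.sSup_le ?_ hC
  rintro c ⟨n, a, ha, rfl⟩
  exact h n a ha

theorem le_cbNorm {φ : E →ₗ[ℂ] F} (hφ : BddAbove (cbSet P Q φ)) {n : ℕ}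
    {a : Matrix (Fin n) (Fin n) E} (ha : P.nrm n a ≤ 1) : Q.nrm n (a.map φ) ≤ cbNorm P Q φ :=
  le_csSup hφ ⟨n, a, ha, rfl⟩

theorem eq_zero_of_cbNorm_eq_zero {φ : E →ₗ[ℂ] F} (hφ : BddAbove (cbSet P Q φ))
    (h : cbNorm P Q φ = 0) : φ = 0 := by
  ext x
  let a : Matrix (Fin 1) (Fin 1) E := Matrix.of fun _ _ => x
  let r : ℝ := 1 + P.nrm 1 a
  have hr : 0 < r := by have := apply_nonneg (P.nrm 1) a; positivity
  have h1 : P.nrm 1 (((r⁻¹ : ℝ) : ℂ) • a) ≤ 1 := by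
    rw [map_smul_eq_mul, Complex.norm_real, Real.norm_of_nonneg (by positivity),
      inv_mul_le_iff₀ hr]
    simp [r]
  have h2 := le_cbNorm hφ h1
  rw [h] at h2
  have h3 := Q.eq_zero _ _ (le_antisymm h2 (apply_nonneg _ _))
  have h4 : φ (((r⁻¹ : ℝ) : ℂ) • x) = 0 := congrFun (congrFun h3 0) 0
  rw [map_smul] at h4
  exact (smul_eq_zero.1 h4).resolve_left (by simpa using hr.ne')

end cb

/-! ### The trace-class spaces -/

/-- The matrix `b` over `n × n` matrices, viewed through the trace pairing as the operator
`M_n → M_m`, `a ↦ (tr (b_{kl} a))_{kl}`. -/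
noncomputable def tracePairing {n m : ℕ} (b : Matrix (Fin m) (Fin m) (Matrix (Fin n) (Fin n) ℂ)) :
    Matrix (Fin n) (Fin n) ℂ →ₗ[ℂ] Matrix (Fin m) (Fin m) ℂ where
  toFun a := Matrix.of fun k l => Matrix.trace (b k l * a)
  map_add' a a' := by ext k l; simp [mul_add]
  map_smul' c a := by ext k l; simp

theorem tracePairing_bddAbove {n m : ℕ}
    (b : Matrix (Fin m) (Fin m) (Matrix (Fin n) (Fin n) ℂ)) :
    BddAbove (cbSet (matrixQuantumNorm n) (matrixQuantumNorm m) (tracePairing b)) := by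
  let γ : Fin m → Fin n → Matrix (Fin m) (Fin n) ℂ := fun k q => Matrix.single k q 1
  let δ : Fin n → Fin m → Matrix (Fin n) (Fin m) ℂ := fun p l => Matrix.single p l 1
  refine ⟨∑ k, ∑ l, ∑ p, ∑ q, ‖b k l p q‖ * (‖γ k q‖ * ‖δ p l‖), ?_⟩
  rintro c ⟨r, a, ha, rfl⟩
  have h : a.map (tracePairing b) =
      ∑ k, ∑ l, ∑ p, ∑ q, b k l p q • a.map fun x => γ k q * x * δ p l := by
    ext i j k l
    simp [tracePairing, γ, δ, Matrix.sum_apply, Matrix.trace, Matrix.mul_apply, Matrix.single,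
      ite_and]
  rw [h]
  have hs : ∀ (ι : Type) (s : Finset ι)
      (f : ι → Matrix (Fin r) (Fin r) (Matrix (Fin m) (Fin m) ℂ)),
      (matrixQuantumNorm m).nrm r (∑ i ∈ s, f i) ≤ ∑ i ∈ s, (matrixQuantumNorm m).nrm r (f i) :=
    fun ι s f => Finset.le_sum_of_subadditive _ (map_zero _).le
      (fun x y => map_add_le_add _ x y) s f
  refine (hs _ _ _).trans (Finset.sum_le_sum fun k _ => ?_)
  refine (hs _ _ _).trans (Finset.sum_le_sum fun l _ => ?_)
  refine (hs _ _ _).trans (Finset.sum_le_sum fun p _ => ?_)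
  refine (hs _ _ _).trans (Finset.sum_le_sum fun q _ => ?_)
  rw [map_smul_eq_mul]
  refine mul_le_mul_of_nonneg_left ?_ (norm_nonneg _)
  refine (norm_comp_map_mul_le (γ k q) a (δ p l)).trans ?_
  have ha' : ‖Matrix.comp _ _ _ _ ℂ a‖ ≤ 1 := ha
  calc ‖γ k q‖ * ‖Matrix.comp _ _ _ _ ℂ a‖ * ‖δ p l‖ ≤ ‖γ k q‖ * 1 * ‖δ p l‖ := by gcongr
    _ = ‖γ k q‖ * ‖δ p l‖ := by ring

theorem tracePairing_sandwich {n m m' : ℕ} (α : Matrix (Fin m') (Fin m) ℂ)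
    (b : Matrix (Fin m) (Fin m) (Matrix (Fin n) (Fin n) ℂ)) (β : Matrix (Fin m) (Fin m') ℂ)
    (a : Matrix (Fin n) (Fin n) ℂ) :
    tracePairing (sandwich α b β) a = α * tracePairing b a * β := by
  ext i j
  simp [tracePairing, sandwich, Matrix.mul_apply, Finset.sum_mul, Matrix.trace_sum]
  rw [Finset.sum_comm]
  refine Finset.sum_congr rfl fun l _ => Finset.sum_congr rfl fun k _ => ?_
  ring

theorem tracePairing_sandwich_le {n m m' : ℕ} (α : Matrix (Fin m') (Fin m) ℂ)
    (b : Matrix (Fin m) (Fin m) (Matrix (Fin n) (Fin n) ℂ)) (β : Matrix (Fin m) (Fin m') ℂ) :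
    cbNorm (matrixQuantumNorm n) (matrixQuantumNorm m') (tracePairing (sandwich α b β)) ≤
      ‖α‖ * cbNorm (matrixQuantumNorm n) (matrixQuantumNorm m) (tracePairing b) * ‖β‖ := by
  have h0 := cbNorm_nonneg (P := matrixQuantumNorm n) (Q := matrixQuantumNorm m) (tracePairing b)
  refine cbNorm_le (by positivity) fun r a ha => ?_
  have h : a.map (tracePairing (sandwich α b β)) =
      (a.map (tracePairing b)).map fun x => α * x * β := by
    funext i j
    exact tracePairing_sandwich α b β (a i j)
  rw [h]
  refine (norm_comp_map_mul_le α (a.map (tracePairing b)) β).trans ?_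
  gcongr
  exact le_cbNorm (tracePairing_bddAbove b) ha

/-- The quantum norm on the space of trace-class operators on `ℂ^n`: each such `b` is identified
with the functional `a ↦ tr (b a)` on `M_n = B(ℂ^n)`, and the space carries the quantum norm of the
quantum dual of `M_n`, that is, `M_m(N_n) ⊆ CB(M_n, M_m)`. -/
noncomputable def traceQuantumNorm (n : ℕ) : QuantumNorm (Matrix (Fin n) (Fin n) ℂ) where
  nrm m := Seminorm.of
    (fun b => cbNorm (matrixQuantumNorm n) (matrixQuantumNorm m) (tracePairing b))
    (fun b c => by
      refine cbNorm_le (add_nonneg (cbNorm_nonneg _) (cbNorm_nonneg _)) fun r a ha => ?_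
      have h : a.map (tracePairing (b + c)) = a.map (tracePairing b) + a.map (tracePairing c) := by
        ext i j k l
        simp [tracePairing, add_mul]
      rw [h]
      exact (map_add_le_add _ _ _).trans (add_le_add (le_cbNorm (tracePairing_bddAbove b) ha)
        (le_cbNorm (tracePairing_bddAbove c) ha)))
    (fun z b => by
      have hz : ∀ (z : ℂ) (b : Matrix (Fin m) (Fin m) (Matrix (Fin n) (Fin n) ℂ)),
          cbNorm (matrixQuantumNorm n) (matrixQuantumNorm m) (tracePairing (z • b)) ≤
          ‖z‖ * cbNorm (matrixQuantumNorm n) (matrixQuantumNorm m) (tracePairing b) := by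
        intro z b
        refine cbNorm_le (mul_nonneg (norm_nonneg _) (cbNorm_nonneg _)) fun r a ha => ?_
        have h : a.map (tracePairing (z • b)) = z • a.map (tracePairing b) := by
          ext i j k l
          simp [tracePairing]
        rw [h, map_smul_eq_mul]
        exact mul_le_mul_of_nonneg_left (le_cbNorm (tracePairing_bddAbove b) ha) (norm_nonneg _)
      refine le_antisymm (hz z b) ?_
      rcases eq_or_ne z 0 with rfl | h0
      · simpa using cbNorm_nonneg _
      · have h1 := hz z⁻¹ (z • b)
        rw [inv_smul_smul₀ h0, norm_inv, ← div_eq_inv_mul,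
          le_div_iff₀ (norm_pos_iff.2 h0), mul_comm] at h1
        exact h1)
  eq_zero m b hb := by
    have h := eq_zero_of_cbNorm_eq_zero (tracePairing_bddAbove b) hb
    ext k l p q
    have h1 := congrFun (congrFun (LinearMap.congr_fun h (Matrix.single q p 1)) k) l
    simpa [tracePairing, Matrix.trace_mul_single] using h1
  nrm_sandwich_le m m' α b β := tracePairing_sandwich_le α b β
  nrm_blockSum m m' b c := by
    refine le_antisymm ?_ ?_
    · refine cbNorm_le (le_max_of_le_left (cbNorm_nonneg _)) fun r a ha => ?_
      have h : Matrix.comp _ _ _ _ ℂ (a.map (tracePairing (blockSum b c))) =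
          (Matrix.fromBlocks (Matrix.comp _ _ _ _ ℂ (a.map (tracePairing b))) 0 0
            (Matrix.comp _ _ _ _ ℂ (a.map (tracePairing c)))).submatrix
            (((Equiv.refl _).prodCongr finSumFinEquiv.symm).trans (Equiv.prodSumDistrib _ _ _))
            (((Equiv.refl _).prodCongr finSumFinEquiv.symm).trans (Equiv.prodSumDistrib _ _ _)) := by
        ext ⟨i, k⟩ ⟨j, l⟩
        obtain ⟨k, rfl⟩ := finSumFinEquiv.surjective k
        obtain ⟨l, rfl⟩ := finSumFinEquiv.surjective l
        rcases k with k | k <;> rcases l with l | l <;>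
          simp [tracePairing, blockSum, -finSumFinEquiv_apply_left, -finSumFinEquiv_apply_right]
      have h1 : ‖Matrix.comp _ _ _ _ ℂ (a.map (tracePairing (blockSum b c)))‖ ≤
          max ‖Matrix.comp _ _ _ _ ℂ (a.map (tracePairing b))‖
            ‖Matrix.comp _ _ _ _ ℂ (a.map (tracePairing c))‖ := by
        rw [h]
        exact (norm_submatrix_le _ _ _).trans (norm_fromBlocks_le _ _)
      exact h1.trans (max_le_max (le_cbNorm (tracePairing_bddAbove b) ha)
        (le_cbNorm (tracePairing_bddAbove c) ha))
    · exact max_le_nrm_blockSum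
        (fun m (b : Matrix (Fin m) (Fin m) (Matrix (Fin n) (Fin n) ℂ)) =>
          cbNorm (matrixQuantumNorm n) (matrixQuantumNorm m) (tracePairing b))
        (fun _ _ => cbNorm_nonneg _) (fun _ _ α b β => tracePairing_sandwich_le α b β) m m' b c

end OpNorm

/-- The quantum norm on a copy of `E` in a higher universe. -/
noncomputable def QuantumNorm.ulift {E : Type*} [AddCommGroup E] [Module ℂ E] (P : QuantumNorm E) :
    QuantumNorm (ULift.{u} E) where
  nrm n := Seminorm.of (fun v => P.nrm n (v.map ULift.down))
    (fun v w => map_add_le_add (P.nrm n) (v.map ULift.down) (w.map ULift.down))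
    (fun c v => map_smul_eq_mul (P.nrm n) c (v.map ULift.down))
  eq_zero n v hv := by
    have h := P.eq_zero n _ hv
    ext i j
    exact congrFun (congrFun h i) j
  nrm_sandwich_le m n α v β := by
    have h : (sandwich α v β).map ULift.down = sandwich α (v.map ULift.down) β := by
      ext i j
      change (ULift.moduleEquiv (R := ℂ) (M := E)) (∑ k, ∑ l, (α i k * β l j) • v k l) = _
      simp [sandwich]
    change P.nrm n ((sandwich α v β).map ULift.down) ≤ _
    rw [h]
    exact P.nrm_sandwich_le m n α _ β
  nrm_blockSum m n v w := by
    have h : (blockSum v w).map ULift.down =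
        blockSum (v.map ULift.down) (w.map ULift.down) := by
      rw [blockSum, ← Matrix.submatrix_map, Matrix.fromBlocks_map]
      rfl
    change P.nrm (m + n) ((blockSum v w).map ULift.down) = _
    rw [h]
    exact P.nrm_blockSum m n _ _

/-- The quantum space `N_n` of trace-class operators on `ℂ^n`, `n = 1, 2, …` (in any universe). -/
noncomputable def traceClass (n : ℕ+) : QNor.{u} where
  carrier := ULift.{u} (Matrix (Fin n) (Fin n) ℂ)
  qnorm := (traceQuantumNorm n).ulift

/-! The theorem reduces to one representability statement: the closed unit ball of M_n(E) is
naturally Hom(N_n, E). Granted this, a point of ⊙(E) is a family of morphisms N_n → E, that is, a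
morphism from the coproduct N_∞. A map from M to ⊙(E) is then a family of morphisms N_∞ → E, that
is, a morphism from the coproduct of copies of N_∞. Coproducts exist because the algebraic direct
sum carries a largest quantum norm making all inclusions completely contractive. Uniqueness is the
Yoneda argument.

A matrix v corresponds to the operator b ↦ ∑ b_{lk} v_{kl}, and v is recovered by applying this
operator to `traceUnit n`, which has norm at most 1 because it represents the identity of M_n. The
hard point is `nrm_map_dualPairing_le`: if ‖v‖ ≤ 1, this operator is completely contractive for an
abstract quantum norm.

If b ∈ M_m(N_n) represents a ↦ ∑ A_i a B_i with ∑ A_i A_iᴴ ≤ r and ∑ B_iᴴ B_i ≤ r, its image in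
M_m(E) is α (v ⊕ ⋯ ⊕ v) β with ‖α‖, ‖β‖ ≤ √r, so Ruan's axioms bound its norm by r. It remains to
produce such a decomposition for each r above the completely bounded norm c of b. This is done by
duality. If (b, r1, r1) lies outside the convex cone `factorCone m n`, a functional (γ, ρ, σ)
separates it, with ρ and σ positive, ρ(1) + σ(1) = 1, and -γ(A ⊗ B) ≤ ρ(A Aᴴ) + σ(Bᴴ B). By
`neg_re_le_cbNorm_of_dominated`, γ is essentially a vector functional of the amplified trace pairing
of b at a single matrix in the unit ball of M_m(M_n). Hence r ≤ -γ(b) ≤ c, a contradiction. -/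

/-! ### Uniqueness of free objects -/

/-- Two free objects with the same base are isomorphic. -/
theorem Rig.IsFree.nonempty_iso {K : Type u₁} [Category.{v₁} K] {L : Type u₂} [Category.{v₂} L]
    {R : Rig K L} {M : L} {F G : K} (hF : R.IsFree M F) (hG : R.IsFree M G) :
    Nonempty (F ≅ G) := by
  obtain ⟨I, hI⟩ := hF
  obtain ⟨I', hI'⟩ := hG
  have hs : ∀ (X Y : K) (f : X ⟶ Y) (h : F ⟶ X),
      (I Y).symm (h ≫ f) = (I X).symm h ≫ R.functor.map f := fun X Y f h => by
    rw [Equiv.symm_apply_eq, hI, Equiv.apply_symm_apply]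
  have hs' : ∀ (X Y : K) (f : X ⟶ Y) (h : G ⟶ X),
      (I' Y).symm (h ≫ f) = (I' X).symm h ≫ R.functor.map f := fun X Y f h => by
    rw [Equiv.symm_apply_eq, hI', Equiv.apply_symm_apply]
  -- `(I F).symm (𝟙 F)` is the universal element of `F`. Each morphism classifies the universal
  -- element of the other object, and naturality shows that the composites classify an object's own
  -- universal element.
  refine ⟨⟨I G ((I' G).symm (𝟙 G)), I' F ((I F).symm (𝟙 F)), ?_, ?_⟩⟩
  · rw [← hI, ← hs', Category.id_comp, Equiv.symm_apply_apply, Equiv.apply_symm_apply]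
  · rw [← hI', ← hs, Category.id_comp, Equiv.symm_apply_apply, Equiv.apply_symm_apply]

/-! ### Naturality of Ruan's operations -/

section Map

variable {E F : Type*} [AddCommGroup E] [Module ℂ E] [AddCommGroup F] [Module ℂ F]

theorem sandwich_map {m n : ℕ} (φ : E →ₗ[ℂ] F) (α : Matrix (Fin n) (Fin m) ℂ)
    (v : Matrix (Fin m) (Fin m) E) (β : Matrix (Fin m) (Fin n) ℂ) :
    (sandwich α v β).map φ = sandwich α (v.map φ) β := by
  ext i j
  simp [sandwich]

theorem blockSum_map {m n : ℕ} (φ : E →ₗ[ℂ] F) (v : Matrix (Fin m) (Fin m) E)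
    (w : Matrix (Fin n) (Fin n) E) :
    (blockSum v w).map φ = blockSum (v.map φ) (w.map φ) := by
  rw [blockSum, ← Matrix.submatrix_map, Matrix.fromBlocks_map]
  simp [blockSum]

end Map

/-! ### Coproducts -/

namespace QNor

open scoped DirectSum

section Coproduct

open scoped Classical in
/-- The operator on the algebraic direct sum induced by a family of morphisms. -/
noncomputable def descLin {J : Type u} {E : J → QNor.{u}} {F : QNor.{u}} (φ : ∀ j, E j ⟶ F) :
    (⨁ j, (E j).carrier) →ₗ[ℂ] F.carrier :=
  DirectSum.toModule ℂ J F.carrier fun j => (φ j).toLin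

variable {J : Type u} (E : J → QNor.{u})

/-- The norms of the images of `v` under all families of morphisms. -/
def coproductNormSet (n : ℕ) (v : Matrix (Fin n) (Fin n) (⨁ j, (E j).carrier)) : Set ℝ :=
  {r | ∃ (F : QNor.{u}) (φ : ∀ j, E j ⟶ F), r = F.qnorm.nrm n (v.map (descLin φ))}

variable {E}

open scoped Classical in
theorem descLin_lof {F : QNor.{u}} (φ : ∀ j, E j ⟶ F) (j : J) (x : (E j).carrier) :
    descLin φ (DirectSum.lof ℂ J (fun j => (E j).carrier) j x) = (φ j).toLin x := by
  unfold descLin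
  exact DirectSum.toModule_lof (M := fun j => (E j).carrier) ℂ j x

-- The bound must be uniform over all targets `F`. By subadditivity it suffices to treat a matrix
-- with a single entry lying in a single summand, where contractivity of `φ j` bounds every image by
-- the norm in `E j`.
open scoped Classical in
theorem coproductNormSet_bddAbove (n : ℕ) (v : Matrix (Fin n) (Fin n) (⨁ j, (E j).carrier)) :
    BddAbove (coproductNormSet E n v) := by
  have add : ∀ v w : Matrix (Fin n) (Fin n) (⨁ j, (E j).carrier),
      BddAbove (coproductNormSet E n v) → BddAbove (coproductNormSet E n w) →
      BddAbove (coproductNormSet E n (v + w)) := by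
    rintro v w ⟨C, hC⟩ ⟨D, hD⟩
    refine ⟨C + D, ?_⟩
    rintro r ⟨F, φ, rfl⟩
    rw [Matrix.map_add _ (map_add _)]
    exact (map_add_le_add _ _ _).trans (add_le_add (hC ⟨F, φ, rfl⟩) (hD ⟨F, φ, rfl⟩))
  have zero : BddAbove (coproductNormSet E n 0) := by
    refine ⟨0, ?_⟩
    rintro r ⟨F, φ, rfl⟩
    simp
  induction v using Matrix.induction_on' with
  | h_zero => exact zero
  | h_add p q hp hq => exact add p q hp hq
  | h_std_basis p q x =>
    induction x using DirectSum.induction_on with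
    | zero => simpa using zero
    | add x y hx hy =>
      rw [Matrix.single_add]
      exact add _ _ hx hy
    | of j x =>
      refine ⟨(E j).qnorm.nrm n (Matrix.single p q x), ?_⟩
      rintro r ⟨F, φ, rfl⟩
      have h : (Matrix.single p q (DirectSum.of (fun j => (E j).carrier) j x)).map (descLin φ) =
          (Matrix.single p q x).map (φ j).toLin := by
        have h1 : descLin φ (DirectSum.of (fun j => (E j).carrier) j x) = (φ j).toLin x :=
          descLin_lof φ j x
        rw [Matrix.map_single, Matrix.map_single, h1]
      rw [h]
      exact (φ j).contractive n _

theorem coproductNormSet_nonneg {n : ℕ} {v : Matrix (Fin n) (Fin n) (⨁ j, (E j).carrier)} :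
    ∀ r ∈ coproductNormSet E n v, 0 ≤ r := by
  rintro r ⟨F, φ, rfl⟩
  exact apply_nonneg _ _

theorem nrm_le_sSup {n : ℕ} {F : QNor.{u}} (φ : ∀ j, E j ⟶ F)
    (v : Matrix (Fin n) (Fin n) (⨁ j, (E j).carrier)) :
    F.qnorm.nrm n (v.map (descLin φ)) ≤ sSup (coproductNormSet E n v) :=
  le_csSup (coproductNormSet_bddAbove n v) ⟨F, φ, rfl⟩

theorem sSup_coproductNormSet_le {n : ℕ} {v : Matrix (Fin n) (Fin n) (⨁ j, (E j).carrier)} {C : ℝ}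
    (hC : 0 ≤ C)
    (h : ∀ (F : QNor.{u}) (φ : ∀ j, E j ⟶ F), F.qnorm.nrm n (v.map (descLin φ)) ≤ C) :
    sSup (coproductNormSet E n v) ≤ C := by
  refine Real.sSup_le ?_ hC
  rintro r ⟨F, φ, rfl⟩
  exact h F φ

variable (E)

open scoped Matrix.Norms.L2Operator in
theorem sSup_coproductNormSet_sandwich_le (m n : ℕ) (α : Matrix (Fin n) (Fin m) ℂ)
    (v : Matrix (Fin m) (Fin m) (⨁ j, (E j).carrier)) (β : Matrix (Fin m) (Fin n) ℂ) :
    sSup (coproductNormSet E n (sandwich α v β)) ≤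
      ‖α‖ * sSup (coproductNormSet E m v) * ‖β‖ := by
  have h0 : 0 ≤ sSup (coproductNormSet E m v) := Real.sSup_nonneg coproductNormSet_nonneg
  refine sSup_coproductNormSet_le (by positivity) fun F φ => ?_
  rw [sandwich_map]
  refine (F.qnorm.nrm_sandwich_le m n α _ β).trans ?_
  gcongr
  exact nrm_le_sSup φ v

/-- The zero morphism. -/
def zeroHom (F G : QNor.{u}) : F ⟶ G :=
  ⟨0, fun n v => by
    have h : v.map (0 : F.carrier →ₗ[ℂ] G.carrier) = 0 := by ext; simp
    rw [h, map_zero]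
    exact apply_nonneg _ _⟩

open scoped Classical Pointwise in
/-- The quantum norm of the coproduct on the algebraic direct sum: the supremum of the norms of the
images under all families of morphisms. -/
noncomputable def coproductQuantumNorm : QuantumNorm (⨁ j, (E j).carrier) where
  nrm n := Seminorm.of (fun v => sSup (coproductNormSet E n v))
    (fun v w => by
      refine sSup_coproductNormSet_le (add_nonneg (Real.sSup_nonneg coproductNormSet_nonneg)
        (Real.sSup_nonneg coproductNormSet_nonneg)) fun F φ => ?_
      rw [Matrix.map_add _ (map_add _)]
      exact (map_add_le_add _ _ _).trans (add_le_add (nrm_le_sSup φ v) (nrm_le_sSup φ w)))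
    (fun c v => by
      have h : coproductNormSet E n (c • v) = ‖c‖ • coproductNormSet E n v := by
        ext r
        simp only [coproductNormSet, Set.mem_smul_set, Set.mem_ofPred_eq]
        have h1 : ∀ (F : QNor.{u}) (φ : ∀ j, E j ⟶ F), F.qnorm.nrm n ((c • v).map (descLin φ)) =
            ‖c‖ * F.qnorm.nrm n (v.map (descLin φ)) := fun F φ => by
          rw [← map_smul_eq_mul]
          congr 1
          ext
          simp
        constructor
        · rintro ⟨F, φ, rfl⟩
          exact ⟨_, ⟨F, φ, rfl⟩, (h1 F φ).symm⟩
        · rintro ⟨_, ⟨F, φ, rfl⟩, rfl⟩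
          exact ⟨F, φ, (h1 F φ).symm⟩
      rw [h, Real.sSup_smul_of_nonneg (norm_nonneg c), smul_eq_mul])
  eq_zero n v hv := by
    ext p q j : 3
    -- This family, the identity on `E j` and zero elsewhere, induces the projection to the `j`-th
    -- component, so a matrix of norm zero has all components zero.
    let φ : ∀ i, E i ⟶ E j := fun i => if h : i = j then eqToHom (by rw [h]) else zeroHom _ _
    have h1 : (E j).qnorm.nrm n (v.map (descLin φ)) ≤ 0 := (nrm_le_sSup φ v).trans hv.le
    have h2 := (E j).qnorm.eq_zero n _ (le_antisymm h1 (apply_nonneg _ _))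
    have h3 : descLin φ (v p q) = 0 := congrFun (congrFun h2 p) q
    have h4 : descLin φ = DirectSum.component ℂ J (fun j => (E j).carrier) j := by
      refine DirectSum.linearMap_ext ℂ fun i => LinearMap.ext fun x => ?_
      rw [LinearMap.comp_apply, LinearMap.comp_apply, descLin_lof]
      by_cases hi : i = j
      · subst hi
        rw [DirectSum.component.lof_self]
        simp only [φ, dif_pos]
        rfl
      · rw [DirectSum.component.of, dif_neg (fun h => hi h)]
        simp only [φ, dif_neg hi]
        rfl
    rw [h4] at h3
    exact h3
  nrm_sandwich_le m n α v β := sSup_coproductNormSet_sandwich_le E m n α v β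
  nrm_blockSum m n v w := by
    refine le_antisymm ?_ ?_
    · refine sSup_coproductNormSet_le
        (le_max_of_le_left (Real.sSup_nonneg coproductNormSet_nonneg)) fun F φ => ?_
      rw [blockSum_map, F.qnorm.nrm_blockSum]
      exact max_le_max (nrm_le_sSup φ v) (nrm_le_sSup φ w)
    · exact max_le_nrm_blockSum
        (fun m (v : Matrix (Fin m) (Fin m) (⨁ j, (E j).carrier)) => sSup (coproductNormSet E m v))
        (fun _ _ => Real.sSup_nonneg coproductNormSet_nonneg)
        (sSup_coproductNormSet_sandwich_le E) m n v w

/-- The coproduct of a family of quantum spaces. -/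
noncomputable def coproduct : QNor.{u} where
  carrier := ⨁ j, (E j).carrier
  qnorm := coproductQuantumNorm E

open scoped Classical in
/-- The inclusion of a summand into the coproduct. -/
noncomputable def coproductInj (j : J) : E j ⟶ coproduct E :=
  ⟨DirectSum.lof ℂ J (fun j => (E j).carrier) j, fun n v => by
    refine sSup_coproductNormSet_le (apply_nonneg _ _) fun F φ => ?_
    have h : (v.map (DirectSum.lof ℂ J (fun j => (E j).carrier) j)).map (descLin φ) =
        v.map (φ j).toLin := by
      ext p q
      exact descLin_lof φ j _
    exact (congrArg (F.qnorm.nrm n) h).trans_le ((φ j).contractive n v)⟩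

/-- The morphism from the coproduct induced by a family of morphisms. -/
noncomputable def coproductDesc {F : QNor.{u}} (φ : ∀ j, E j ⟶ F) : coproduct E ⟶ F :=
  ⟨descLin φ, fun _ v => nrm_le_sSup φ v⟩

/-- The universal property of the coproduct. -/
noncomputable def coproductIsColimit : IsColimit (Cofan.mk (coproduct E) (coproductInj E)) :=
  Cofan.IsColimit.mk _ (fun s => coproductDesc E s.inj)
    (fun s j => Hom.ext (LinearMap.ext fun x => descLin_lof s.inj j x))
    (fun s f hf => Hom.ext (by
      classical
      refine DirectSum.linearMap_ext ℂ fun j => LinearMap.ext fun x => ?_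
      refine Eq.trans ?_ (descLin_lof s.inj j x).symm
      exact LinearMap.congr_fun (congrArg Hom.toLin (hf j)) x))

end Coproduct

end QNor

theorem QNor.hasCoproducts : HasCoproducts.{u} QNor.{u} :=
  hasCoproducts_of_colimit_cofans (fun E => Cofan.mk (QNor.coproduct E) (QNor.coproductInj E))
    QNor.coproductIsColimit

/-! ### Matrices over `E` as operators from `N_n` to `E` -/

section Pairing

variable {E : Type*} [AddCommGroup E] [Module ℂ E] {n : ℕ}

/-- The operator `b ↦ ∑ b_{lk} v_{kl}` from `n × n` matrices to `E` given by `v ∈ M_n(E)`. -/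
def dualPairing (v : Matrix (Fin n) (Fin n) E) : Matrix (Fin n) (Fin n) ℂ →ₗ[ℂ] E where
  toFun b := ∑ k, ∑ l, b l k • v k l
  map_add' b c := by simp [add_smul, Finset.sum_add_distrib]
  map_smul' z b := by simp [mul_smul, Finset.smul_sum]

theorem dualPairing_apply (v : Matrix (Fin n) (Fin n) E) (b : Matrix (Fin n) (Fin n) ℂ) :
    dualPairing v b = ∑ k, ∑ l, b l k • v k l := rfl

/-- The matrix over `n × n` matrices whose trace pairing is the identity operator. -/
def traceUnit (n : ℕ) : Matrix (Fin n) (Fin n) (Matrix (Fin n) (Fin n) ℂ) :=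
  Matrix.of fun k l => Matrix.single l k 1

theorem tracePairing_traceUnit (n : ℕ) : tracePairing (traceUnit n) = LinearMap.id := by
  ext a k l
  simp [tracePairing, traceUnit, Matrix.trace_single_mul]

theorem nrm_traceUnit_le (n : ℕ) : (traceQuantumNorm n).nrm n (traceUnit n) ≤ 1 := by
  change cbNorm _ _ (tracePairing (traceUnit n)) ≤ 1
  refine cbNorm_le zero_le_one fun r a ha => ?_
  rw [tracePairing_traceUnit]
  exact ha

/-- Together with `dualPairing_traceUnit_map`, this makes `v ↦ dualPairing v` and evaluation at
`traceUnit n` mutually inverse. -/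
theorem traceUnit_map_dualPairing (v : Matrix (Fin n) (Fin n) E) :
    (traceUnit n).map (dualPairing v) = v := by
  ext k l
  simp [traceUnit, dualPairing_apply, Matrix.single_apply, ite_and]

theorem dualPairing_traceUnit_map (φ : Matrix (Fin n) (Fin n) ℂ →ₗ[ℂ] E) :
    dualPairing ((traceUnit n).map φ) = φ := by
  refine LinearMap.ext fun b => ?_
  conv_rhs => rw [Matrix.matrix_eq_sum_single b]
  rw [dualPairing_apply, Finset.sum_comm]
  simp only [map_sum]
  refine Finset.sum_congr rfl fun l _ => Finset.sum_congr rfl fun k _ => ?_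
  rw [Matrix.map_apply, ← map_smul]
  simp [traceUnit]

end Pairing

/-! ### Separation from a cone with an order unit -/

/-- A point outside a cone with an order unit `e` is separated from the cone by a functional of
value `1` at `e`. -/
theorem PointedCone.exists_separating_of_orderUnit {X : Type*} [AddCommGroup X] [Module ℝ X]
    (C : PointedCone ℝ X) {e x : X} (he : e ∈ C) (he' : -e ∉ C)
    (habs : ∀ y, ∃ t : ℝ, t • e + y ∈ C) (hx : x ∉ C) :
    ∃ g : X →ₗ[ℝ] ℝ, g e = 1 ∧ (∀ y ∈ C, 0 ≤ g y) ∧ g x ≤ 0 := by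
  have smul : ∀ (t : ℝ) (y : X), 0 ≤ t → y ∈ C → t • y ∈ C := fun t y ht hy =>
    Submodule.smul_mem C (⟨t, ht⟩ : {t : ℝ // 0 ≤ t}) hy
  have he0 : e ≠ 0 := fun h => he' (by rw [h, neg_zero]; exact C.zero_mem)
  -- Nonnegativity on the enlarged cone forces `g x ≤ 0`. The extension theorem of M. Riesz then
  -- needs only that no negative multiple of `e` lies in `D`: `t • e = y - c • x` with `t < 0` would
  -- put `-e` in `C` if `c = 0`, and `x` in `C` if `c > 0`.
  let D : PointedCone ℝ X := C ⊔ Submodule.span {t : ℝ // 0 ≤ t} {-x}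
  let f : X →ₗ.[ℝ] ℝ := LinearPMap.mkSpanSingleton e 1 he0
  have hf : ∀ t : ℝ, ∀ h, f ⟨t • e, h⟩ = t := fun t h => by
    exact (LinearPMap.mkSpanSingleton'_apply e (1 : ℝ) _ t h).trans (by simp)
  have hmem : ∀ t : ℝ, t • e ∈ f.domain := fun t => Submodule.mem_span_singleton.2 ⟨t, rfl⟩
  obtain ⟨g, hg1, hg2⟩ := riesz_extension D f (by
    rintro ⟨_, h⟩ hy
    obtain ⟨t, rfl⟩ := Submodule.mem_span_singleton.1 h
    rw [hf]
    by_contra! ht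
    obtain ⟨y, hy, z, hz, hyz⟩ := Submodule.mem_sup.1 hy
    obtain ⟨⟨c, hc⟩, rfl⟩ := Submodule.mem_span_singleton.1 hz
    replace hyz : y + c • (-x) = t • e := hyz
    have h1 : y + (-t) • e = c • x := by
      rw [neg_smul, ← hyz, smul_neg]
      abel
    rcases hc.eq_or_lt with rfl | hc
    · apply he'
      have h2 := smul (-t)⁻¹ y (by simpa using ht.le) hy
      have h3 : y = t • e := by rw [← hyz, zero_smul, add_zero]
      rw [h3, smul_smul, inv_neg, neg_mul, inv_mul_cancel₀ ht.ne, neg_smul, one_smul] at h2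
      exact h2
    · apply hx
      have h2 := smul c⁻¹ _ (by positivity) (C.add_mem hy (smul (-t) e (by linarith) he))
      rwa [h1, smul_smul, inv_mul_cancel₀ hc.ne', one_smul] at h2)
    (fun y => by
      obtain ⟨t, ht⟩ := habs y
      exact ⟨⟨t • e, hmem t⟩, Submodule.mem_sup_left ht⟩)
  refine ⟨g, ?_, fun y hy => hg2 y (Submodule.mem_sup_left hy), ?_⟩
  · have := hg1 ⟨(1 : ℝ) • e, hmem 1⟩
    rw [hf] at this
    simpa using this
  · have := hg2 (-x) (Submodule.mem_sup_right (Submodule.mem_span_singleton_self _))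
    rw [map_neg] at this
    linarith

/-! ### Factorizations of trace pairings -/

section Factor

open scoped Matrix Matrix.Norms.L2Operator

variable {m n : ℕ}

/-- The matrix over `n × n` matrices whose trace pairing is the operator `a ↦ A a B`. -/
noncomputable def opTensor : Matrix (Fin m) (Fin n) ℂ →ₗ[ℂ] Matrix (Fin n) (Fin m) ℂ →ₗ[ℂ]
    Matrix (Fin m) (Fin m) (Matrix (Fin n) (Fin n) ℂ) :=
  LinearMap.mk₂ ℂ (fun A B => Matrix.of fun i j => Matrix.of fun l k => A i k * B l j)
    (fun _ _ _ => by ext; simp [add_mul]) (fun _ _ _ => by ext; simp [mul_assoc])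
    (fun _ _ _ => by ext; simp [mul_add]) (fun _ _ _ => by ext; simp [mul_left_comm])

theorem opTensor_apply (A : Matrix (Fin m) (Fin n) ℂ) (B : Matrix (Fin n) (Fin m) ℂ)
    (i j : Fin m) (l k : Fin n) : opTensor A B i j l k = A i k * B l j := rfl

theorem opTensor_map_dualPairing {E : Type*} [AddCommGroup E] [Module ℂ E]
    (v : Matrix (Fin n) (Fin n) E) (A : Matrix (Fin m) (Fin n) ℂ) (B : Matrix (Fin n) (Fin m) ℂ) :
    (opTensor A B).map (dualPairing v) = sandwich A v B := rfl

theorem tracePairing_opTensor (A : Matrix (Fin m) (Fin n) ℂ) (B : Matrix (Fin n) (Fin m) ℂ)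
    (a : Matrix (Fin n) (Fin n) ℂ) : tracePairing (opTensor A B) a = A * a * B := by
  ext i j
  simp only [tracePairing, LinearMap.coe_mk, AddHom.coe_mk, Matrix.of_apply, Matrix.trace,
    Matrix.diag_apply, Matrix.mul_apply, opTensor_apply, Finset.sum_mul]
  refine Finset.sum_congr rfl fun l _ => Finset.sum_congr rfl fun k _ => ?_
  ring

/-- A matrix unit with matrix-unit entry is the tensor of two matrix units. Scalars are absorbed
into the first factor, so no step for scalar multiples is needed. -/
theorem opTensor_induction {p : Matrix (Fin m) (Fin m) (Matrix (Fin n) (Fin n) ℂ) → Prop}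
    (b : Matrix (Fin m) (Fin m) (Matrix (Fin n) (Fin n) ℂ))
    (tensor : ∀ A B, p (opTensor A B)) (add : ∀ b c, p b → p c → p (b + c)) : p b := by
  have zero : p 0 := by simpa using tensor 0 0
  induction b using Matrix.induction_on' with
  | h_zero => exact zero
  | h_add b c hb hc => exact add b c hb hc
  | h_std_basis i j x =>
    induction x using Matrix.induction_on' with
    | h_zero => simpa using zero
    | h_add x y hx hy =>
      rw [Matrix.single_add]
      exact add _ _ hx hy
    | h_std_basis l k z =>
      convert tensor (Matrix.single i k z) (Matrix.single l j 1) using 1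
      ext i' j' l' k'
      rw [opTensor_apply]
      by_cases h1 : i = i' <;> by_cases h2 : j = j' <;> by_cases h3 : l = l' <;>
        by_cases h4 : k = k' <;> simp [h1, h2, h3, h4]

/-- The triples `(b, U, V)` where `b` represents an operator `a ↦ A a B` with
`A Aᴴ ≤ U` and `Bᴴ B ≤ V`. -/
def factorTriples (m n : ℕ) : Set (Matrix (Fin m) (Fin m) (Matrix (Fin n) (Fin n) ℂ) ×
    Matrix (Fin m) (Fin m) ℂ × Matrix (Fin m) (Fin m) ℂ) :=
  {x | ∃ A B, x.1 = opTensor A B ∧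
    (∀ y : Fin m → ℂ, ∑ k, ‖(Aᴴ *ᵥ y) k‖ ^ 2 ≤ (star y ⬝ᵥ x.2.1 *ᵥ y).re) ∧
    (∀ y : Fin m → ℂ, ∑ k, ‖(B *ᵥ y) k‖ ^ 2 ≤ (star y ⬝ᵥ x.2.2 *ᵥ y).re)}

/-- The convex cone generated by `factorTriples m n`. -/
noncomputable def factorCone (m n : ℕ) : PointedCone ℝ
    (Matrix (Fin m) (Fin m) (Matrix (Fin n) (Fin n) ℂ) ×
    Matrix (Fin m) (Fin m) ℂ × Matrix (Fin m) (Fin m) ℂ) :=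
  PointedCone.hull ℝ (factorTriples m n)

theorem re_star_dotProduct_self (y : Fin m → ℂ) : (star y ⬝ᵥ y).re = ∑ i, ‖y i‖ ^ 2 := by
  simp [dotProduct, Complex.sq_norm, Complex.normSq_apply]

/-! ### Evaluating members of the cone in a quantum space -/

section Quantum

variable {E : Type*} [AddCommGroup E] [Module ℂ E]

/-- A row times a block-diagonal matrix times a column: this merges a sum of factorizations into
one, whose middle factor is controlled by Ruan's block-sum axiom. -/
theorem sandwich_append_blockSum {k l : ℕ} (α : Matrix (Fin m) (Fin k) ℂ)
    (α' : Matrix (Fin m) (Fin l) ℂ) (v : Matrix (Fin k) (Fin k) E) (w : Matrix (Fin l) (Fin l) E)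
    (β : Matrix (Fin k) (Fin m) ℂ) (β' : Matrix (Fin l) (Fin m) ℂ) :
    sandwich (Matrix.of fun i => Fin.append (α i) (α' i)) (blockSum v w)
      (Matrix.of fun i j => Fin.append (fun k => β k j) (fun k => β' k j) i) =
      sandwich α v β + sandwich α' w β' := by
  ext i j
  simp [sandwich, blockSum, Fin.sum_univ_add]

/-- In a quantum space, the members of `factorCone` give factorizations through block sums. -/
theorem exists_sandwich_of_mem_factorCone (Q : QuantumNorm E) {v : Matrix (Fin n) (Fin n) E}
    (hv : Q.nrm n v ≤ 1) {x} (hx : x ∈ factorCone m n) :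
    ∃ (N : ℕ) (α : Matrix (Fin m) (Fin N) ℂ) (w : Matrix (Fin N) (Fin N) E)
      (β : Matrix (Fin N) (Fin m) ℂ), Q.nrm N w ≤ 1 ∧
      x.1.map (dualPairing v) = sandwich α w β ∧
      (∀ y : Fin m → ℂ, ∑ k, ‖(αᴴ *ᵥ y) k‖ ^ 2 ≤ (star y ⬝ᵥ x.2.1 *ᵥ y).re) ∧
      (∀ y : Fin m → ℂ, ∑ k, ‖(β *ᵥ y) k‖ ^ 2 ≤ (star y ⬝ᵥ x.2.2 *ᵥ y).re) := by
  refine Submodule.span_induction ?_ ?_ ?_ ?_ hx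
  · rintro x ⟨A, B, h1, h2, h3⟩
    exact ⟨n, A, v, B, hv, by rw [h1, opTensor_map_dualPairing], h2, h3⟩
  · refine ⟨0, 0, 0, 0, by simp, ?_, by simp, by simp⟩
    ext i j
    simp [sandwich]
  · rintro x y - - ⟨k, α, w, β, hw, h1, h2, h3⟩ ⟨l, α', w', β', hw', h1', h2', h3'⟩
    refine ⟨k + l, Matrix.of fun i => Fin.append (α i) (α' i), blockSum w w',
      Matrix.of fun i j => Fin.append (fun k => β k j) (fun k => β' k j) i, ?_, ?_, fun z => ?_, fun z => ?_⟩
    · rw [Q.nrm_blockSum]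
      exact max_le hw hw'
    · rw [sandwich_append_blockSum, ← h1, ← h1', Prod.fst_add, Matrix.map_add _ (map_add _)]
    · refine le_trans (le_of_eq ?_) ((add_le_add (h2 z) (h2' z)).trans_eq ?_)
      · simp [Fin.sum_univ_add, Matrix.mulVec, dotProduct]
      · simp [Matrix.add_mulVec]
    · refine le_trans (le_of_eq ?_) ((add_le_add (h3 z) (h3' z)).trans_eq ?_)
      · simp [Fin.sum_univ_add, Matrix.mulVec, dotProduct]
      · simp [Matrix.add_mulVec]
  · rintro ⟨c, hc⟩ x - ⟨k, α, w, β, hw, h1, h2, h3⟩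
    have hsq : ((√c : ℝ) : ℂ) * ((√c : ℝ) : ℂ) = (c : ℂ) := by
      rw [← Complex.ofReal_mul, Real.mul_self_sqrt hc]
    -- The factor `c` is split evenly, since the bounds by `U` and `V` are quadratic in `α` and `β`.
    refine ⟨k, ((√c : ℝ) : ℂ) • α, w, ((√c : ℝ) : ℂ) • β, hw, ?_, fun z => ?_, fun z => ?_⟩
    · have h4 : ((⟨c, hc⟩ : {t : ℝ // 0 ≤ t}) • x).1.map (dualPairing v) =
          (c : ℂ) • x.1.map (dualPairing v) := by
        ext i j
        exact map_smul (dualPairing v) (c : ℂ) (x.1 i j)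
      rw [h4, h1]
      ext i j
      simp only [sandwich, Matrix.smul_apply, Matrix.of_apply, Finset.smul_sum, smul_smul,
        smul_eq_mul, ← hsq]
      refine Finset.sum_congr rfl fun _ _ => Finset.sum_congr rfl fun _ _ => ?_
      congr 1
      ring
    · have h4 : (star z ⬝ᵥ ((⟨c, hc⟩ : {t : ℝ // 0 ≤ t}) • x).2.1 *ᵥ z).re =
          c * (star z ⬝ᵥ x.2.1 *ᵥ z).re := by
        change (star z ⬝ᵥ (c • x.2.1) *ᵥ z).re = _
        simp [Matrix.smul_mulVec]
      rw [h4]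
      refine le_trans (le_of_eq ?_) (mul_le_mul_of_nonneg_left (h2 z) hc)
      simp [Matrix.smul_mulVec, mul_pow, Finset.mul_sum, Real.sq_sqrt hc]
    · have h4 : (star z ⬝ᵥ ((⟨c, hc⟩ : {t : ℝ // 0 ≤ t}) • x).2.2 *ᵥ z).re =
          c * (star z ⬝ᵥ x.2.2 *ᵥ z).re := by
        change (star z ⬝ᵥ (c • x.2.2) *ᵥ z).re = _
        simp [Matrix.smul_mulVec]
      rw [h4]
      refine le_trans (le_of_eq ?_) (mul_le_mul_of_nonneg_left (h3 z) hc)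
      simp [Matrix.smul_mulVec, mul_pow, Finset.mul_sum, Real.sq_sqrt hc]

/-- For `U = V = r • 1` the two quadratic bounds say `‖α‖, ‖β‖ ≤ √r`, and Ruan's first axiom gives
`√r * 1 * √r`. -/
theorem nrm_map_dualPairing_le_of_mem_factorCone (Q : QuantumNorm E)
    {v : Matrix (Fin n) (Fin n) E} (hv : Q.nrm n v ≤ 1)
    {b : Matrix (Fin m) (Fin m) (Matrix (Fin n) (Fin n) ℂ)} {r : ℝ} (hr : 0 ≤ r)
    (h : (b, r • (1 : Matrix (Fin m) (Fin m) ℂ), r • (1 : Matrix (Fin m) (Fin m) ℂ)) ∈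
      factorCone m n) : Q.nrm m (b.map (dualPairing v)) ≤ r := by
  obtain ⟨N, α, w, β, hw, h1, h2, h3⟩ := exists_sandwich_of_mem_factorCone Q hv h
  have hre : ∀ y : Fin m → ℂ, (star y ⬝ᵥ (r • (1 : Matrix (Fin m) (Fin m) ℂ)) *ᵥ y).re =
      √r ^ 2 * ∑ i, ‖y i‖ ^ 2 := fun y => by
    rw [Real.sq_sqrt hr, ← re_star_dotProduct_self]
    simp [Matrix.smul_mulVec]
  have hα : ‖α‖ ≤ √r := by
    rw [← Matrix.l2_opNorm_conjTranspose]
    exact opNorm_le (Real.sqrt_nonneg r) fun y => (h2 y).trans_eq (hre y)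
  have hβ : ‖β‖ ≤ √r := opNorm_le (Real.sqrt_nonneg r) fun y => (h3 y).trans_eq (hre y)
  refine (congrArg (Q.nrm m) h1).trans_le ((Q.nrm_sandwich_le N m α w β).trans ?_)
  have h0 := apply_nonneg (Q.nrm N) w
  calc ‖α‖ * Q.nrm N w * ‖β‖ ≤ √r * 1 * √r := by gcongr
    _ = r := by rw [mul_one, Real.mul_self_sqrt hr]

end Quantum

theorem abs_re_star_dotProduct_mulVec_le (U : Matrix (Fin m) (Fin m) ℂ) (y : Fin m → ℂ) :
    |(star y ⬝ᵥ U *ᵥ y).re| ≤ ‖U‖ * ∑ i, ‖y i‖ ^ 2 := by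
  have h1 : star y ⬝ᵥ U *ᵥ y = inner ℂ (WithLp.toLp 2 y) (WithLp.toLp 2 (U *ᵥ y)) := by
    rw [EuclideanSpace.inner_eq_star_dotProduct, dotProduct_comm]
  have h2 : ∑ i, ‖y i‖ ^ 2 = ‖WithLp.toLp 2 y‖ ^ 2 := by
    rw [EuclideanSpace.norm_sq_eq]
  rw [h1, h2]
  refine (Complex.abs_re_le_norm _).trans ((norm_inner_le_norm _ _).trans ?_)
  calc _ ≤ ‖WithLp.toLp 2 y‖ * (‖U‖ * ‖WithLp.toLp 2 y‖) := by
        gcongr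
        exact Matrix.l2_opNorm_mulVec U (WithLp.toLp 2 y)
    _ = _ := by ring

theorem factorCone_absorbing (x : Matrix (Fin m) (Fin m) (Matrix (Fin n) (Fin n) ℂ) ×
    Matrix (Fin m) (Fin m) ℂ × Matrix (Fin m) (Fin m) ℂ) :
    ∃ t : ℝ, t • ((0, 1, 1) : Matrix (Fin m) (Fin m) (Matrix (Fin n) (Fin n) ℂ) ×
      Matrix (Fin m) (Fin m) ℂ × Matrix (Fin m) (Fin m) ℂ) + x ∈ factorCone m n := by
  have hre : ∀ (t : ℝ) (U : Matrix (Fin m) (Fin m) ℂ) (y : Fin m → ℂ),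
      (star y ⬝ᵥ (t • 1 + U) *ᵥ y).re = t * ∑ i, ‖y i‖ ^ 2 + (star y ⬝ᵥ U *ᵥ y).re := by
    intro t U y
    rw [← re_star_dotProduct_self]
    simp [Matrix.smul_mulVec, Matrix.add_mulVec]
  obtain ⟨b, U, V⟩ := x
  induction b using opTensor_induction with
  | tensor A B =>
    refine ⟨‖Aᴴ‖ ^ 2 + ‖B‖ ^ 2 + ‖U‖ + ‖V‖, PointedCone.subset_hull ⟨A, B, ?_, fun y => ?_, fun y => ?_⟩⟩
    · simp
    · change _ ≤ (star y ⬝ᵥ ((‖Aᴴ‖ ^ 2 + ‖B‖ ^ 2 + ‖U‖ + ‖V‖) • 1 + U) *ᵥ y).re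
      rw [hre]
      have h1 := (abs_le.1 (abs_re_star_dotProduct_mulVec_le U y)).1
      have h2 := sum_mulVec_le Aᴴ y
      have h3 : 0 ≤ (‖B‖ ^ 2 + ‖V‖) * ∑ i, ‖y i‖ ^ 2 := by positivity
      linarith
    · change _ ≤ (star y ⬝ᵥ ((‖Aᴴ‖ ^ 2 + ‖B‖ ^ 2 + ‖U‖ + ‖V‖) • 1 + V) *ᵥ y).re
      rw [hre]
      have h1 := (abs_le.1 (abs_re_star_dotProduct_mulVec_le V y)).1
      have h2 := sum_mulVec_le B y
      have h3 : 0 ≤ (‖Aᴴ‖ ^ 2 + ‖U‖) * ∑ i, ‖y i‖ ^ 2 := by positivity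
      linarith
  | add b c hb hc =>
    obtain ⟨s, hs⟩ := hb
    obtain ⟨t, ht⟩ := hc
    refine ⟨s + t + ‖U‖ + ‖V‖, ?_⟩
    -- Both induction hypotheses contain the same `U` and `V`, so their sum contains each twice. The
    -- surplus is removed by adding `(0, -U, -V)`, compensated by a multiple of the order unit.
    have h0 : (((‖U‖ + ‖V‖) • (0, 1, 1) : Matrix (Fin m) (Fin m) (Matrix (Fin n) (Fin n) ℂ) ×
        Matrix (Fin m) (Fin m) ℂ × Matrix (Fin m) (Fin m) ℂ) + (0, -U, -V)) ∈ factorCone m n := by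
      refine PointedCone.subset_hull ⟨0, 0, ?_, fun y => ?_, fun y => ?_⟩
      · simp
      · change _ ≤ (star y ⬝ᵥ ((‖U‖ + ‖V‖) • 1 + -U) *ᵥ y).re
        rw [hre]
        have h1 := (abs_le.1 (abs_re_star_dotProduct_mulVec_le U y)).2
        have h3 : 0 ≤ ‖V‖ * ∑ i, ‖y i‖ ^ 2 := by positivity
        simp only [Matrix.neg_mulVec, dotProduct_neg, Complex.neg_re]
        simp
        linarith
      · change _ ≤ (star y ⬝ᵥ ((‖U‖ + ‖V‖) • 1 + -V) *ᵥ y).re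
        rw [hre]
        have h1 := (abs_le.1 (abs_re_star_dotProduct_mulVec_le V y)).2
        have h3 : 0 ≤ ‖U‖ * ∑ i, ‖y i‖ ^ 2 := by positivity
        simp only [Matrix.neg_mulVec, dotProduct_neg, Complex.neg_re]
        simp
        linarith
    convert (factorCone m n).add_mem ((factorCone m n).add_mem hs ht) h0 using 1
    refine Prod.ext ?_ (Prod.ext ?_ ?_)
    · simp
    · simp; module
    · simp; module

end Factor

/-! ### Positive functionals on matrices -/

section States

open scoped Matrix Matrix.Norms.L2Operator ComplexOrder MatrixOrder

variable {m n : ℕ}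

theorem trace_conjTranspose_mul_self_re {κ : Type*} [Fintype κ] (A : Matrix κ (Fin m) ℂ) :
    (Aᴴ * A).trace.re = ∑ k, ∑ i, ‖A k i‖ ^ 2 := by
  rw [Finset.sum_comm]
  simp [Matrix.trace, Matrix.mul_apply, Complex.sq_norm, Complex.normSq_apply]

/-- A real functional on matrices is the real part of the trace against a matrix. -/
theorem exists_eq_re_trace_mul (ρ : Matrix (Fin m) (Fin m) ℂ →ₗ[ℝ] ℝ) :
    ∃ R : Matrix (Fin m) (Fin m) ℂ, ∀ U, ρ U = (R * U).trace.re := by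
  let ρc : Matrix (Fin m) (Fin m) ℂ →ₗ[ℂ] ℂ := Module.Dual.extendRCLike (𝕜 := ℂ) ρ
  refine ⟨Matrix.of fun i j => ρc (Matrix.single j i 1), fun U => ?_⟩
  have h : ∀ U, ρ U = (ρc U).re := fun U => (Module.Dual.re_extendRCLike_apply (𝕜 := ℂ) ρ U).symm
  rw [h]
  congr 1
  conv_lhs => rw [Matrix.matrix_eq_sum_single U]
  simp only [map_sum, Matrix.trace, Matrix.diag_apply, Matrix.mul_apply, Matrix.of_apply]
  rw [Finset.sum_comm]
  refine Finset.sum_congr rfl fun i _ => Finset.sum_congr rfl fun j _ => ?_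
  rw [mul_comm, ← smul_eq_mul, ← map_smul]
  simp

/-- The hypothesis also covers non-Hermitian `U`. A skew-Hermitian matrix and its negative both have
form of real part zero, so `ρ` vanishes on it. Hence a representing matrix can be replaced by its
Hermitian part, whose positivity is tested on the rank-one matrices `x xᴴ`. -/
theorem exists_posSemidef_eq_re_trace_mul (ρ : Matrix (Fin m) (Fin m) ℂ →ₗ[ℝ] ℝ)
    (hρ : ∀ U, (∀ y : Fin m → ℂ, 0 ≤ (star y ⬝ᵥ U *ᵥ y).re) → 0 ≤ ρ U) :
    ∃ R : Matrix (Fin m) (Fin m) ℂ, R.PosSemidef ∧ ∀ U, ρ U = (R * U).trace.re := by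
  obtain ⟨R, hR⟩ := exists_eq_re_trace_mul ρ
  have hform : ∀ (U : Matrix (Fin m) (Fin m) ℂ) (y : Fin m → ℂ),
      (star y ⬝ᵥ Uᴴ *ᵥ y).re = (star y ⬝ᵥ U *ᵥ y).re := fun U y => by
    have : star y ⬝ᵥ Uᴴ *ᵥ y = star (star y ⬝ᵥ U *ᵥ y) := by
      rw [Matrix.star_dotProduct, Matrix.star_mulVec, Matrix.dotProduct_mulVec,
        Matrix.conjTranspose_conjTranspose]
    rw [this]
    simp
  have hstar : ∀ U, ρ Uᴴ = ρ U := fun U => by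
    have h1 := hρ (U - Uᴴ) fun y => by
      rw [Matrix.sub_mulVec, dotProduct_sub, Complex.sub_re, hform, sub_self]
    have h2 := hρ (Uᴴ - U) fun y => by
      rw [Matrix.sub_mulVec, dotProduct_sub, Complex.sub_re, hform, sub_self]
    rw [map_sub] at h1 h2
    linarith
  have htr : ∀ U, ρ U = (Rᴴ * U).trace.re := fun U => by
    rw [← hstar, hR, ← Complex.conj_re]
    change (star (R * Uᴴ).trace).re = _
    rw [← Matrix.trace_conjTranspose, Matrix.conjTranspose_mul, Matrix.conjTranspose_conjTranspose,
      Matrix.trace_mul_comm]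
  let S : Matrix (Fin m) (Fin m) ℂ := (2⁻¹ : ℝ) • (R + Rᴴ)
  have hS : ∀ U, ρ U = (S * U).trace.re := fun U => by
    have h1 := hR U
    have h2 := htr U
    simp only [S, Matrix.smul_mul, Matrix.add_mul, Matrix.trace_smul, Matrix.trace_add]
    simp
    linarith
  have hSH : S.IsHermitian := by
    simp [S, Matrix.IsHermitian, Matrix.conjTranspose_smul, add_comm]
  refine ⟨S, Matrix.PosSemidef.of_dotProduct_mulVec_nonneg hSH fun x => ?_, hS⟩
  have h1 : (star x ⬝ᵥ S *ᵥ x).re = ρ (Matrix.vecMulVec x (star x)) := by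
    rw [hS, Matrix.mul_vecMulVec, Matrix.trace_vecMulVec, dotProduct_comm]
  have h2 : 0 ≤ ρ (Matrix.vecMulVec x (star x)) := hρ _ fun y => by
    rw [Matrix.vecMulVec_mulVec]
    have : star y ⬝ᵥ MulOpposite.op (star x ⬝ᵥ y) • x =
        star (star x ⬝ᵥ y) * (star x ⬝ᵥ y) := by
      rw [dotProduct_smul, ← Matrix.star_dotProduct]
      simp
    rw [this]
    simp [← Complex.normSq_eq_conj_mul_self, Complex.normSq_nonneg]
  rw [Complex.le_def]
  refine ⟨by simpa [h1] using h2, ?_⟩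
  exact (hSH.im_star_dotProduct_mulVec_self x).symm

/-- Up to a small multiple of the trace, a positive functional on matrices is given by an
invertible matrix. -/
theorem exists_isUnit_re_trace (ρ : Matrix (Fin m) (Fin m) ℂ →ₗ[ℝ] ℝ)
    (hρ : ∀ U, (∀ y : Fin m → ℂ, 0 ≤ (star y ⬝ᵥ U *ᵥ y).re) → 0 ≤ ρ U) {ε : ℝ} (hε : 0 < ε) :
    ∃ K : Matrix (Fin m) (Fin m) ℂ, IsUnit K.det ∧
      (∀ A : Matrix (Fin m) (Fin n) ℂ, ρ (A * Aᴴ) ≤ ∑ i, ∑ k, ‖(K * A) i k‖ ^ 2) ∧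
      ∑ i, ∑ j, ‖K i j‖ ^ 2 = ρ 1 + m * ε := by
  obtain ⟨R, hR, hRρ⟩ := exists_posSemidef_eq_re_trace_mul ρ hρ
  -- The perturbation by `ε` makes the square root `K` invertible, at the cost of `m * ε` in its
  -- Hilbert–Schmidt norm squared.
  have hT : (R + (ε : ℂ) • (1 : Matrix (Fin m) (Fin m) ℂ)).PosDef :=
    Matrix.PosDef.posSemidef_add hR (Matrix.PosDef.one.smul (by exact_mod_cast hε))
  obtain ⟨K, hK⟩ : ∃ K : Matrix (Fin m) (Fin m) ℂ,
      Kᴴ * K = R + (ε : ℂ) • (1 : Matrix (Fin m) (Fin m) ℂ) := by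
    have h0 : 0 ≤ R + (ε : ℂ) • (1 : Matrix (Fin m) (Fin m) ℂ) :=
      Matrix.nonneg_iff_posSemidef.2 hT.posSemidef
    refine ⟨CFC.sqrt (R + (ε : ℂ) • (1 : Matrix (Fin m) (Fin m) ℂ)), ?_⟩
    have h1 : (CFC.sqrt (R + (ε : ℂ) • (1 : Matrix (Fin m) (Fin m) ℂ)))ᴴ = CFC.sqrt _ :=
      (IsSelfAdjoint.of_nonneg (CFC.sqrt_nonneg _)).star_eq
    rw [h1, CFC.sqrt_mul_sqrt_self _ h0]
  have htr : ∀ U, ρ U + ε * U.trace.re = (Kᴴ * K * U).trace.re := fun U => by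
    rw [hK, hRρ, Matrix.add_mul, Matrix.trace_add, Complex.add_re, Matrix.smul_mul, Matrix.one_mul,
      Matrix.trace_smul]
    simp
  refine ⟨K, ?_, fun A => ?_, ?_⟩
  · have h1 : IsUnit (Kᴴ * K).det := by
      rw [hK]
      exact (Matrix.isUnit_iff_isUnit_det _).1 hT.isUnit
    rw [Matrix.det_mul] at h1
    exact isUnit_of_mul_isUnit_right h1
  · have h1 := htr (A * Aᴴ)
    have h2 : (Kᴴ * K * (A * Aᴴ)).trace = ((K * A)ᴴ * (K * A)).trace := by
      rw [Matrix.conjTranspose_mul, ← Matrix.mul_assoc, Matrix.trace_mul_comm]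
      simp only [Matrix.mul_assoc]
    have h3 : 0 ≤ (A * Aᴴ).trace.re := by
      rw [Matrix.trace_mul_comm, trace_conjTranspose_mul_self_re]
      positivity
    rw [h2, trace_conjTranspose_mul_self_re] at h1
    nlinarith
  · have h1 := htr 1
    rw [Matrix.mul_one, trace_conjTranspose_mul_self_re] at h1
    rw [← h1]
    simp [mul_comm]

end States

/-! ### Dominated functionals and the completely bounded norm -/

section Duality

open scoped Matrix Matrix.Norms.L2Operator

variable {m n : ℕ}

/-- Cauchy–Schwarz, followed by the arithmetic–geometric mean inequality. The arithmetic mean is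
used because the sum `ρ 1 + σ 1` is what the separation normalizes. -/
theorem norm_bilinear_le {ι κ : Type*} [Fintype ι] [Fintype κ] [DecidableEq κ] (M : Matrix ι κ ℂ)
    (x : ι → ℂ) (y : κ → ℂ) : ‖x ⬝ᵥ M *ᵥ y‖ ≤ ‖M‖ * ((∑ i, ‖x i‖ ^ 2 + ∑ j, ‖y j‖ ^ 2) / 2) := by
  have h1 : x ⬝ᵥ M *ᵥ y = inner ℂ (WithLp.toLp 2 (star x)) (WithLp.toLp 2 (M *ᵥ y)) := by
    rw [EuclideanSpace.inner_eq_star_dotProduct, dotProduct_comm]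
    simp
  have h2 : ∑ i, ‖x i‖ ^ 2 = ‖WithLp.toLp 2 (star x)‖ ^ 2 := by
    rw [EuclideanSpace.norm_sq_eq]
    simp
  have h3 : ∑ i, ‖y i‖ ^ 2 = ‖WithLp.toLp 2 y‖ ^ 2 := by
    rw [EuclideanSpace.norm_sq_eq]
  rw [h1, h2, h3]
  refine (norm_inner_le_norm _ _).trans ?_
  calc _ ≤ ‖WithLp.toLp 2 (star x)‖ * (‖M‖ * ‖WithLp.toLp 2 y‖) := by
        gcongr
        exact Matrix.l2_opNorm_mulVec M (WithLp.toLp 2 y)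
    _ = ‖M‖ * (‖WithLp.toLp 2 (star x)‖ * ‖WithLp.toLp 2 y‖) := by ring
    _ ≤ _ := by
        gcongr
        nlinarith [sq_nonneg (‖WithLp.toLp 2 (star x)‖ - ‖WithLp.toLp 2 y‖)]

-- With matrices read as vectors, `1 ⊗ B` sends `L` to `B * L`, and `1 ⊗ A` acting from the right
-- sends `K` to `K * A`. Thus `A` and `B` move from the operator onto the vectors.
open scoped Kronecker in
theorem dotProduct_comp_map_mul_mulVec (X : Matrix (Fin m) (Fin m) (Matrix (Fin n) (Fin n) ℂ))
    (K : Matrix (Fin m) (Fin m) ℂ) (A : Matrix (Fin m) (Fin n) ℂ) (B : Matrix (Fin n) (Fin m) ℂ)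
    (L : Matrix (Fin m) (Fin m) ℂ) :
    (fun p : Fin m × Fin m => K p.1 p.2) ⬝ᵥ
      (Matrix.comp _ _ _ _ ℂ (X.map fun a => A * a * B)) *ᵥ (fun q => L q.2 q.1) =
    (fun p : Fin m × Fin n => (K * A) p.1 p.2) ⬝ᵥ
      (Matrix.comp _ _ _ _ ℂ X) *ᵥ (fun q => (B * L) q.2 q.1) := by
  have h1 : ((1 : Matrix (Fin m) (Fin m) ℂ) ⊗ₖ B) *ᵥ (fun q => L q.2 q.1) =
      fun q => (B * L) q.2 q.1 := by
    ext ⟨j, l⟩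
    simp [Matrix.mulVec, dotProduct, Fintype.sum_prod_type, Matrix.one_apply, Matrix.mul_apply]
  have h2 : (fun p : Fin m × Fin m => K p.1 p.2) ᵥ* ((1 : Matrix (Fin m) (Fin m) ℂ) ⊗ₖ A) =
      fun p => (K * A) p.1 p.2 := by
    ext ⟨j, l⟩
    simp [Matrix.vecMul, dotProduct, Fintype.sum_prod_type, Matrix.one_apply, Matrix.mul_apply]
  rw [comp_map_mul, ← Matrix.mulVec_mulVec, ← Matrix.mulVec_mulVec, h1, Matrix.dotProduct_mulVec,
    h2]

/-- A functional on matrices over `n × n` matrices which is dominated by two positive functionals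
`ρ` and `σ` on all operators `a ↦ A a B` is dominated by the completely bounded norm. -/
theorem neg_re_le_cbNorm_of_dominated
    (G : Matrix (Fin m) (Fin m) (Matrix (Fin n) (Fin n) ℂ) →ₗ[ℂ] ℂ)
    (ρ σ : Matrix (Fin m) (Fin m) ℂ →ₗ[ℝ] ℝ)
    (hρ : ∀ U, (∀ y : Fin m → ℂ, 0 ≤ (star y ⬝ᵥ U *ᵥ y).re) → 0 ≤ ρ U)
    (hσ : ∀ U, (∀ y : Fin m → ℂ, 0 ≤ (star y ⬝ᵥ U *ᵥ y).re) → 0 ≤ σ U)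
    (hG : ∀ A B, -(G (opTensor A B)).re ≤ ρ (A * Aᴴ) + σ (Bᴴ * B))
    (b : Matrix (Fin m) (Fin m) (Matrix (Fin n) (Fin n) ℂ)) {ε : ℝ} (hε : 0 < ε) :
    -(G b).re ≤ (ρ 1 + σ 1 + 2 * m * ε) *
      cbNorm (matrixQuantumNorm n) (matrixQuantumNorm m) (tracePairing b) := by
  obtain ⟨K, hK, hKρ, hK1⟩ := exists_isUnit_re_trace (n := n) ρ hρ hε
  obtain ⟨L, hL, hLσ, hL1⟩ := exists_isUnit_re_trace (n := n) σ hσ hε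
  have hLH : IsUnit (Lᴴ).det := by
    rw [Matrix.det_conjTranspose]
    exact hL.star
  -- The matrix of the bilinear form `(A, B) ↦ G (opTensor (K⁻¹ * A) (B * (Lᴴ)⁻¹))`. After this
  -- change of variables the domination reads: minus the real part of the form is at most the sum of
  -- the squared Hilbert–Schmidt norms of `A` and `B`.
  let M : Matrix (Fin m × Fin n) (Fin m × Fin n) ℂ := Matrix.of fun p q =>
    G (opTensor (K⁻¹ * Matrix.single p.1 p.2 (1 : ℂ))
      (Matrix.single q.2 q.1 (1 : ℂ) * (Lᴴ)⁻¹))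
  have hM : ∀ (A : Matrix (Fin m) (Fin n) ℂ) (B : Matrix (Fin n) (Fin m) ℂ),
      (fun p : Fin m × Fin n => A p.1 p.2) ⬝ᵥ M *ᵥ (fun q => B q.2 q.1) =
        G (opTensor (K⁻¹ * A) (B * (Lᴴ)⁻¹)) := fun A B => by
    have e1 : ∀ X, G (opTensor (K⁻¹ * A) X) =
        ∑ i, ∑ k, A i k * G (opTensor (K⁻¹ * Matrix.single i k (1 : ℂ)) X) := fun X => by
      have e : ∀ (i : Fin m) (k : Fin n), Matrix.single i k (A i k) =
          A i k • Matrix.single i k (1 : ℂ) := fun i k => by simp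
      conv_lhs => rw [Matrix.matrix_eq_sum_single A]
      simp only [e, Matrix.mul_sum, Matrix.mul_smul, map_sum, map_smul, LinearMap.sum_apply,
        LinearMap.smul_apply, smul_eq_mul]
    have e2 : ∀ X, G (opTensor X (B * (Lᴴ)⁻¹)) =
        ∑ l, ∑ j, B l j * G (opTensor X (Matrix.single l j (1 : ℂ) * (Lᴴ)⁻¹)) := fun X => by
      have e : ∀ (l : Fin n) (j : Fin m), Matrix.single l j (B l j) =
          B l j • Matrix.single l j (1 : ℂ) := fun l j => by simp
      conv_lhs => rw [Matrix.matrix_eq_sum_single B]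
      simp only [e, Matrix.sum_mul, Matrix.smul_mul, map_sum, map_smul, smul_eq_mul]
    rw [e1]
    simp only [dotProduct, Matrix.mulVec, Fintype.sum_prod_type, M, Matrix.of_apply]
    refine Finset.sum_congr rfl fun i _ => Finset.sum_congr rfl fun k _ => ?_
    rw [e2, Finset.sum_comm]
    refine congrArg _ (Finset.sum_congr rfl fun l _ => Finset.sum_congr rfl fun j _ => ?_)
    ring
  have hMnorm : ‖M‖ ≤ 2 := by
    refine opNorm_le (by norm_num) fun z => ?_
    set w := M *ᵥ z with hw
    -- With this `A` and with `B` given by `z`, domination becomes `‖w‖² / 2 ≤ ‖w‖² / 4 + ‖z‖²`,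
    -- that is, `‖M z‖² ≤ 4 ‖z‖²`.
    let A : Matrix (Fin m) (Fin n) ℂ := Matrix.of fun i k => -(1 / 2 : ℂ) * star (w (i, k))
    let B : Matrix (Fin n) (Fin m) ℂ := Matrix.of fun l j => z (j, l)
    have h1 := hG (K⁻¹ * A) (B * (Lᴴ)⁻¹)
    rw [← hM] at h1
    have h2 : (fun p : Fin m × Fin n => A p.1 p.2) ⬝ᵥ M *ᵥ (fun q => B q.2 q.1) =
        -((1 / 2 * ∑ p, ‖w p‖ ^ 2 : ℝ) : ℂ) := by
      change (fun p : Fin m × Fin n => A p.1 p.2) ⬝ᵥ M *ᵥ z = _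
      rw [← hw]
      simp only [dotProduct, A, Matrix.of_apply]
      push_cast
      rw [Finset.mul_sum, ← Finset.sum_neg_distrib]
      refine Finset.sum_congr rfl fun p _ => ?_
      rw [← Complex.conj_mul' (w p)]
      change -(1 / 2 : ℂ) * (starRingEnd ℂ) (w p) * w p = _
      ring
    have h3 := hKρ (K⁻¹ * A)
    rw [Matrix.mul_nonsing_inv_cancel_left _ _ hK] at h3
    have h4 := hLσ (B * (Lᴴ)⁻¹)ᴴ
    have h5 : L * (B * (Lᴴ)⁻¹)ᴴ = Bᴴ := by
      rw [← Matrix.conjTranspose_conjTranspose L, ← Matrix.conjTranspose_mul,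
        Matrix.conjTranspose_conjTranspose, Matrix.nonsing_inv_mul_cancel_right _ _ hLH]
    rw [h5, Matrix.conjTranspose_conjTranspose] at h4
    have h6 : ∑ i, ∑ k, ‖A i k‖ ^ 2 = 1 / 4 * ∑ p, ‖w p‖ ^ 2 := by
      rw [Fintype.sum_prod_type, Finset.mul_sum]
      refine Finset.sum_congr rfl fun i _ => ?_
      rw [Finset.mul_sum]
      refine Finset.sum_congr rfl fun k _ => ?_
      simp only [A, Matrix.of_apply, norm_mul, norm_neg, norm_star, mul_pow]
      norm_num
    have h7 : ∑ i, ∑ k, ‖Bᴴ i k‖ ^ 2 = ∑ p, ‖z p‖ ^ 2 := by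
      simp [Fintype.sum_prod_type, B]
    rw [h2, Complex.neg_re, Complex.ofReal_re] at h1
    linarith
  let a : Matrix (Fin m) (Fin m) (Matrix (Fin n) (Fin n) ℂ) :=
    (2⁻¹ : ℂ) • (Matrix.comp _ _ _ _ ℂ).symm M
  have ha : (matrixQuantumNorm n).nrm m a ≤ 1 := by
    rw [map_smul_eq_mul]
    have : (matrixQuantumNorm n).nrm m ((Matrix.comp _ _ _ _ ℂ).symm M) = ‖M‖ := rfl
    rw [this]
    norm_num
    linarith
  -- Undoing the change of variables: `G` is a vector functional, given by `K` and `Lᴴ`, of the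
  -- amplified pairing at the fixed element `a` of the unit ball. Both sides are additive in `b`, so
  -- tensors suffice.
  have hG' : ∀ b, G b = 2 * ((fun p : Fin m × Fin m => K p.1 p.2) ⬝ᵥ
      (Matrix.comp _ _ _ _ ℂ (a.map (tracePairing b))) *ᵥ fun q => (Lᴴ) q.2 q.1) := fun b => by
    induction b using opTensor_induction with
    | tensor A B =>
      have h1 := hM (K * A) (B * Lᴴ)
      rw [Matrix.nonsing_inv_mul_cancel_left _ _ hK, Matrix.mul_nonsing_inv_cancel_right _ _ hLH]
        at h1
      have h2 : a.map (tracePairing (opTensor A B)) = a.map fun x => A * x * B := by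
        funext i j
        exact tracePairing_opTensor A B (a i j)
      have h3 : Matrix.comp _ _ _ _ ℂ a = (2⁻¹ : ℂ) • M := rfl
      rw [← h1, h2, dotProduct_comp_map_mul_mulVec, h3, Matrix.smul_mulVec, dotProduct_smul,
        smul_eq_mul, mul_inv_cancel_left₀ two_ne_zero]
    | add b c hb hc =>
      have : a.map (tracePairing (b + c)) = a.map (tracePairing b) + a.map (tracePairing c) := by
        ext i j k l
        simp [tracePairing, add_mul]
      rw [map_add, hb, hc, this]
      have h2 : ∀ x y : Matrix (Fin m) (Fin m) (Matrix (Fin m) (Fin m) ℂ),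
        Matrix.comp _ _ _ _ ℂ (x + y) = Matrix.comp _ _ _ _ ℂ x + Matrix.comp _ _ _ _ ℂ y :=
        fun _ _ => rfl
      rw [h2, Matrix.add_mulVec, dotProduct_add]
      ring
  have hT := le_cbNorm (tracePairing_bddAbove b) ha
  have hT' : ‖Matrix.comp _ _ _ _ ℂ (a.map (tracePairing b))‖ ≤
    cbNorm (matrixQuantumNorm n) (matrixQuantumNorm m) (tracePairing b) := hT
  refine (neg_le_abs _).trans ((Complex.abs_re_le_norm _).trans ?_)
  rw [hG', norm_mul]
  have h8 := norm_bilinear_le (Matrix.comp _ _ _ _ ℂ (a.map (tracePairing b)))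
    (fun p : Fin m × Fin m => K p.1 p.2) (fun q => (Lᴴ) q.2 q.1)
  have h9 : ∑ p : Fin m × Fin m, ‖K p.1 p.2‖ ^ 2 = ρ 1 + m * ε := by
    rw [Fintype.sum_prod_type, hK1]
  have h10 : ∑ p : Fin m × Fin m, ‖(Lᴴ) p.2 p.1‖ ^ 2 = σ 1 + m * ε := by
    rw [Fintype.sum_prod_type, ← hL1]
    simp
  rw [h9, h10] at h8
  have h11 : 0 ≤ (ρ 1 + m * ε + (σ 1 + m * ε)) / 2 := by
    rw [← h9, ← h10]
    positivity
  calc _ ≤ 2 * (cbNorm (matrixQuantumNorm n) (matrixQuantumNorm m) (tracePairing b) *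
        ((ρ 1 + m * ε + (σ 1 + m * ε)) / 2)) := by
        rw [Complex.norm_ofNat]
        exact mul_le_mul_of_nonneg_left
          (h8.trans (mul_le_mul_of_nonneg_right hT' h11)) zero_le_two
    _ = _ := by ring

/-- The amplifications of the operator given by a matrix in the unit ball are contractive on
matrices over the trace-class space. -/
theorem nrm_map_dualPairing_le {E : Type*} [AddCommGroup E] [Module ℂ E] (Q : QuantumNorm E)
    {v : Matrix (Fin n) (Fin n) E} (hv : Q.nrm n v ≤ 1)
    (b : Matrix (Fin m) (Fin m) (Matrix (Fin n) (Fin n) ℂ)) :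
    Q.nrm m (b.map (dualPairing v)) ≤ (traceQuantumNorm n).nrm m b := by
  -- For `m = 0` the order unit used below would be zero.
  rcases Nat.eq_zero_or_pos m with rfl | hm
  · rw [Subsingleton.elim (b.map (dualPairing v)) 0, map_zero]
    exact apply_nonneg _ _
  change _ ≤ cbNorm (matrixQuantumNorm n) (matrixQuantumNorm m) (tracePairing b)
  set c := cbNorm (matrixQuantumNorm n) (matrixQuantumNorm m) (tracePairing b) with hc
  have hc0 : 0 ≤ c := cbNorm_nonneg _
  by_contra! hlt
  obtain ⟨r, hcr, hr⟩ := exists_between hlt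
  have hmem : ∀ U V : Matrix (Fin m) (Fin m) ℂ,
      (∀ y : Fin m → ℂ, 0 ≤ (star y ⬝ᵥ U *ᵥ y).re) →
      (∀ y : Fin m → ℂ, 0 ≤ (star y ⬝ᵥ V *ᵥ y).re) → (0, U, V) ∈ factorCone m n :=
    fun U V hU hV => PointedCone.subset_hull ⟨0, 0, by simp, by simpa using hU, by simpa using hV⟩
  have hone : ∀ y : Fin m → ℂ, 0 ≤ (star y ⬝ᵥ (1 : Matrix (Fin m) (Fin m) ℂ) *ᵥ y).re :=
    fun y => by
      rw [Matrix.one_mulVec, re_star_dotProduct_self]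
      positivity
  have hzero : ∀ y : Fin m → ℂ, 0 ≤ (star y ⬝ᵥ (0 : Matrix (Fin m) (Fin m) ℂ) *ᵥ y).re :=
    fun y => by simp
  obtain ⟨g, hg1, hg2, hg3⟩ := (factorCone m n).exists_separating_of_orderUnit
    (e := (0, 1, 1)) (x := (b, r • 1, r • 1)) (hmem 1 1 hone hone)
    -- Membership of `-e` would make the form of `-1` nonnegative, but at the all-ones vector it
    -- equals `-m < 0`.
    (fun h => by
      obtain ⟨N, α, w, β, -, -, h2, -⟩ := exists_sandwich_of_mem_factorCone Q hv h
      have h3 := h2 fun _ => 1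
      have h4 : (0 : ℝ) ≤ ∑ k, ‖(αᴴ *ᵥ fun _ => 1) k‖ ^ 2 := by positivity
      replace h3 := h4.trans h3
      simp only [Prod.snd_neg, Prod.fst_neg, Matrix.neg_mulVec, Matrix.one_mulVec, dotProduct_neg,
        Complex.neg_re, re_star_dotProduct_self] at h3
      simp at h3
      omega)
    factorCone_absorbing
    (fun h => hr.not_ge (nrm_map_dualPairing_le_of_mem_factorCone Q hv (hc0.trans hcr.le) h))
  let ρ : Matrix (Fin m) (Fin m) ℂ →ₗ[ℝ] ℝ := g ∘ₗ LinearMap.inr ℝ _ _ ∘ₗ LinearMap.inl ℝ _ _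
  let σ : Matrix (Fin m) (Fin m) ℂ →ₗ[ℝ] ℝ := g ∘ₗ LinearMap.inr ℝ _ _ ∘ₗ LinearMap.inr ℝ _ _
  let γ : Matrix (Fin m) (Fin m) (Matrix (Fin n) (Fin n) ℂ) →ₗ[ℝ] ℝ := g ∘ₗ LinearMap.inl ℝ _ _
  have hsplit : ∀ b U V, g (b, U, V) = γ b + (ρ U + σ V) := fun b U V => by
    change _ = g (b, 0, 0) + (g (0, U, 0) + g (0, 0, V))
    rw [← map_add, ← map_add]
    simp
  let G : Matrix (Fin m) (Fin m) (Matrix (Fin n) (Fin n) ℂ) →ₗ[ℂ] ℂ :=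
    Module.Dual.extendRCLike (𝕜 := ℂ) γ
  have hG : ∀ b, (G b).re = γ b := fun b => Module.Dual.re_extendRCLike_apply (𝕜 := ℂ) γ b
  have hρσ : ρ 1 + σ 1 = 1 := by
    rw [hsplit, map_zero, zero_add] at hg1
    exact hg1
  -- Separation of `(b, r • 1, r • 1)` gives `r ≤ -γ b`, as `ρ 1 + σ 1 = 1`. The domination
  -- hypothesis is positivity of `g` on `(opTensor A B, A * Aᴴ, Bᴴ * B)`. Letting `ε` tend to 0
  -- contradicts `c < r`.
  have main : ∀ ε : ℝ, 0 < ε → r ≤ (1 + 2 * m * ε) * c := fun ε hε => by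
    have h := neg_re_le_cbNorm_of_dominated G ρ σ (fun U hU => hg2 _ (hmem U 0 hU hzero))
      (fun V hV => hg2 _ (hmem 0 V hzero hV)) (fun A B => ?_) b hε
    · rw [hρσ, hG] at h
      rw [hsplit, map_smul, map_smul, smul_eq_mul, smul_eq_mul, ← mul_add, hρσ] at hg3
      linarith
    · have h1 := hg2 (opTensor A B, A * Aᴴ, Bᴴ * B) (PointedCone.subset_hull
        ⟨A, B, rfl, fun y => le_of_eq ?_, fun y => le_of_eq ?_⟩)
      · rw [hsplit] at h1
        rw [hG]
        linarith
      · rw [← re_star_dotProduct_self, Matrix.star_mulVec, ← Matrix.dotProduct_mulVec,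
          Matrix.mulVec_mulVec, Matrix.conjTranspose_conjTranspose]
      · rw [← re_star_dotProduct_self, Matrix.star_mulVec, ← Matrix.dotProduct_mulVec,
          Matrix.mulVec_mulVec]
  have hlim : Filter.Tendsto (fun ε : ℝ => (1 + 2 * m * ε) * c) (nhdsWithin 0 (Set.Ioi 0))
      (nhds ((1 + 2 * m * 0) * c)) :=
    (Continuous.tendsto (by fun_prop) 0).mono_left nhdsWithin_le_nhds
  have := ge_of_tendsto hlim (Filter.eventually_of_mem self_mem_nhdsWithin main)
  linarith

end Duality

/-! ### The trace-class spaces represent the unit balls -/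

/-- Elements of the unit ball of `M_n(E)` are the same as morphisms from `N_n` to `E`. -/
noncomputable def ballEquivHom (n : ℕ+) (E : QNor.{u}) :
    {v : Matrix (Fin n) (Fin n) E.carrier // E.qnorm.nrm n v ≤ 1} ≃ (traceClass.{u} n ⟶ E) where
  toFun v := ⟨dualPairing v.1 ∘ₗ (ULift.moduleEquiv (R := ℂ)).toLinearMap, fun _ b =>
    nrm_map_dualPairing_le E.qnorm v.2 (b.map ULift.down)⟩
  invFun φ := ⟨((traceUnit n).map ULift.up).map φ.toLin,
    (φ.contractive n _).trans (nrm_traceUnit_le n)⟩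
  left_inv v := Subtype.ext (traceUnit_map_dualPairing v.1)
  right_inv φ := QNor.Hom.ext (LinearMap.ext fun b => LinearMap.congr_fun
    (dualPairing_traceUnit_map (φ.toLin ∘ₗ (ULift.moduleEquiv (R := ℂ)).symm.toLinearMap)) b.down)

theorem ballEquivHom_map (n : ℕ+) {E F : QNor.{u}} (f : E ⟶ F)
    (v : {v : Matrix (Fin n) (Fin n) E.carrier // E.qnorm.nrm n v ≤ 1}) :
    ballEquivHom n F ⟨v.1.map f.toLin, (f.contractive n v.1).trans v.2⟩ =
      ballEquivHom n E v ≫ f := by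
  refine QNor.Hom.ext (LinearMap.ext fun b => ?_)
  change dualPairing (v.1.map f.toLin) b.down = f.toLin (dualPairing v.1 b.down)
  simp [dualPairing_apply]

/-- Families of morphisms from the members of a family are morphisms from its coproduct. -/
def Cofan.homEquiv {K : Type u₁} [Category.{v₁} K] {J : Type v₂} {X : J → K} {c : Cofan X}
    (hc : IsColimit c) (E : K) : (∀ j, X j ⟶ E) ≃ (c.pt ⟶ E) where
  toFun φ := Cofan.IsColimit.desc hc φ
  invFun f j := c.inj j ≫ f
  left_inv φ := by
    funext j
    exact Cofan.IsColimit.fac hc φ j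
  right_inv f := Cofan.IsColimit.hom_ext hc _ _ fun j => Cofan.IsColimit.fac hc _ j

theorem Cofan.homEquiv_comp {K : Type u₁} [Category.{v₁} K] {J : Type v₂} {X : J → K}
    {c : Cofan X} (hc : IsColimit c) {E F : K} (f : E ⟶ F) (φ : ∀ j, X j ⟶ E) :
    Cofan.homEquiv hc F (fun j => φ j ≫ f) = Cofan.homEquiv hc E φ ≫ f := by
  rw [← Equiv.eq_symm_apply]
  funext j
  change φ j ≫ f = c.inj j ≫ Cofan.IsColimit.desc hc φ ≫ f
  rw [← Category.assoc, Cofan.IsColimit.fac]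

/-! ### Free quantum spaces as coproducts -/

section Free

variable {N : Cofan (fun n : ℕ+ => traceClass.{u} n)}

/-- The points of `⊙ E` are the morphisms from `N_∞` to `E`. -/
noncomputable def pointEquivHom (hN : IsColimit N) (E : QNor.{u}) : ballFunctor.obj E ≃ (N.pt ⟶ E) :=
  (Equiv.piCongrRight fun n => ballEquivHom n E).trans (Cofan.homEquiv hN E)

theorem pointEquivHom_map (hN : IsColimit N) {E F : QNor.{u}} (f : E ⟶ F) (x : ballFunctor.obj E) :
    pointEquivHom hN F (ballFunctor.map f x) = pointEquivHom hN E x ≫ f := by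
  refine Eq.trans ?_ (Cofan.homEquiv_comp hN f fun n => ballEquivHom n E (x n))
  refine congrArg (Cofan.homEquiv hN F) (funext fun n => ?_)
  exact ballEquivHom_map n f (x n)

/-- Maps from `M` to a type are families indexed by `M`. -/
def typeHomEquiv (M X : Type u) : (M ⟶ X) ≃ (M → X) where
  toFun g := g
  invFun g := TypeCat.ofHom g
  left_inv _ := rfl
  right_inv _ := rfl

theorem isFree_of_unique (hN : IsColimit N) (T : Type u) [Unique T] : ballRig.IsFree T N.pt := by
  refine ⟨fun E => ((typeHomEquiv T (ballFunctor.obj E)).trans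
    (Equiv.funUnique T _)).trans (pointEquivHom hN E), fun E F f g => ?_⟩
  exact pointEquivHom_map hN f (g default)

theorem isFree_coproduct (hN : IsColimit N) (M : Type u) {c : Cofan (fun _ : M => N.pt)} (hc : IsColimit c) :
    ballRig.IsFree M c.pt := by
  refine ⟨fun E => ((typeHomEquiv M (ballFunctor.obj E)).trans
    (Equiv.piCongrRight fun _ => pointEquivHom hN E)).trans (Cofan.homEquiv hc E),
    fun E F f g => ?_⟩
  refine Eq.trans ?_ (Cofan.homEquiv_comp hc f fun t => pointEquivHom hN E (g t))
  refine congrArg (Cofan.homEquiv hc F) (funext fun t => ?_)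
  exact pointEquivHom_map hN f (g t)

end Free

/-! ### The main theorem -/

theorem theorem5p9 :
    HasCoproducts.{u} QNor.{u} ∧
    HasCoproduct (fun n : ℕ+ => traceClass.{u} n) ∧
    ballRig.{u}.FreedomLoving ∧
    ∀ N : Cofan (fun n : ℕ+ => traceClass.{u} n), Nonempty (IsColimit N) →
      (∀ (T : Type u) [Unique T],
        ballRig.IsFree T N.pt ∧
        ∀ F : QNor.{u}, ballRig.IsFree T F → Nonempty (F ≅ N.pt)) ∧
      (∀ (M : Type u) (c : Cofan (fun _ : M => N.pt)), Nonempty (IsColimit c) →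
        ballRig.IsFree M c.pt ∧
        ∀ F : QNor.{u}, ballRig.IsFree M F → Nonempty (F ≅ c.pt)) := by
  have h1 : HasCoproducts.{u} QNor.{u} := QNor.hasCoproducts
  -- The index set `ℕ+` lives in the lowest universe, whereas `h1` concerns index sets in universe
  -- `u`.
  have h0 : HasCoproducts.{0} QNor.{u} := hasCoproducts_shrink.{0, u}
  have h2 : HasCoproduct (fun n : ℕ+ => traceClass.{u} n) :=
    (h0 ℕ+).has_colimit _
  refine ⟨h1, h2, fun M => ?_, ?_⟩
  · exact ⟨_, isFree_coproduct (colimit.isColimit (Discrete.functor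
      fun n : ℕ+ => traceClass.{u} n)) M (QNor.coproductIsColimit fun _ : M => _)⟩
  · rintro N ⟨hN⟩
    refine ⟨fun T _ => ?_, ?_⟩
    · exact ⟨isFree_of_unique hN T, fun F hF => hF.nonempty_iso (isFree_of_unique hN T)⟩
    · rintro M c ⟨hc⟩
      exact ⟨isFree_coproduct hN M hc, fun F hF => hF.nonempty_iso (isFree_coproduct hN M hc)⟩
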